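/- Let $U=\begin{pmatrix} l_1&l_2\\ r_1&r_2\end{pmatrix}$ be a $2\times2$ unitary matrix with $\det U=1$, and put $L=\begin{pmatrix} l_1&l_2\\0&0\end{pmatrix}$, $R=\begin{pmatrix}0&0\\ r_1&r_2\end{pmatrix}$. Let $\psi_0=(\psi_0(x))_{x\in\mathbb Z}\in\ell^2(\mathbb Z,\mathbb C^2)$, $\psi_0(x)=(\psi_0(1;x),\psi_0(2;x))^{T}$, be a unit vector, and define $\psi_{n+1}(x)=L\psi_n(x+1)+R\psi_n(x-1)$ for $n\ge0$, $x\in\mathbb Z$. For each $n\ge 0$ let $X_n$ be a $\mathbb Z$-valued random variable with $\mathbb P(X_n=x)=\|\psi_n(x)\|^2$ for all $x\in\mathbb Z$. Then there is a real random variable $Z$, whose law $\mu$ depends only on $U$ and $\psi_0$, such that $X_n/n\to Z$ in distribution as $n\to\infty$. Moreover: (i) If $l_1l_2r_1r_2\neq0$, then $\mu$ is absolutely continuous with respect to Lebesgue measure, with density $$\rho(y)=\frac{\sqrt{1-|l_1|^2}}{\pi(1-y^2)\sqrt{|l_1|^2-y^2}}\;g(y)\quad\text{for } y\in(-|l_1|,|l_1|),\qquad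 \rho(y)=0\ \text{ otherwise},$$ where $g\ge 0$ is the following function, which contains the dependence on the initial state. Let $\hat\psi_0(k)=\frac1{\sqrt{2\pi}}\sum_{x\in\mathbb Z}\psi_0(x)e^{ixk}$ (a $2\pi$-periodic function, the series converging in $L^2$), let $\theta_1\in(-\pi,\pi]$ be the argument of $l_1$, let $\gamma(k)=\arccos(|l_1|\cos k)\in[0,\pi]$, and let $S(k)$ be the matrix with columns $$e_\pm(k)=\begin{pmatrix} e^{-ik}\\ -\frac{e^{i\theta_1}}{l_2}\left(|l_1|e^{-ik}-e^{\pm i\gamma(k)}\right)\end{pmatrix},$$ which are eigenvectors of $e^{-i(k+\theta_1)}L+e^{i(k+\theta_1)}R$ for the eigenvalues $e^{\pm i\gamma(k)}$. Let $(a_+(k),a_-(k))^{T}=S(k)^{-1}\hat\psi_0(k+\theta_1)$ and $w_\pm(k)=\|a_\pm(k)e_\pm(k)\|^2$. With $$c_1(y)=\arcsin\frac{\sqrt{1-|l_1|^2}\;y}{|l_1|\sqrt{1-y^2}},\qquad c_2(y)=\pi-c_1(y),$$ the two solutions modulo $2\pi$ of $\gamma'(c)=y$, $$g(y)=\pi\left[w_+(c_1(y))+w_+(c_2(y))+w_-(-c_1(y))+w_-(-c_2(y))\right].$$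 (ii) If $l_2=0$, then $\mu=\Big(\sum_{x\in\mathbb Z}|\psi_0(1;x)|^2\Big)\delta_{-1}+\Big(\sum_{x\in\mathbb Z}|\psi_0(2;x)|^2\Big)\delta_{1}$. (iii) If $l_1=0$, then $\mu=\delta_0$. -/

import Mathlib

open MeasureTheory ProbabilityTheory Filter Topology
open scoped ENNReal Matrix

noncomputable section

namespace QuantumWalk

instance fact_two_pi_pos : Fact (0 < 2 * Real.pi) := ⟨Real.two_pi_pos⟩

/-- The Hilbert space `ℓ²(ℤ, ℂ²)` of the walk; the coordinates `0` and `1` of `ℂ²` are the left and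
the right chirality. -/
abbrev State : Type := lp (fun _ : ℤ => EuclideanSpace ℂ (Fin 2)) 2

/-- The matrix `L`: first row of the coin `U`, second row zero. -/
def leftPart (U : Matrix (Fin 2) (Fin 2) ℂ) : Matrix (Fin 2) (Fin 2) ℂ :=
  !![U 0 0, U 0 1; 0, 0]

/-- The matrix `R`: first row zero, second row of the coin `U`. -/
def rightPart (U : Matrix (Fin 2) (Fin 2) ℂ) : Matrix (Fin 2) (Fin 2) ℂ :=
  !![0, 0; U 1 0, U 1 1]

/-- The amplitudes at time `n`, given by `ψ_{n+1}(x) = L ψ_n(x+1) + R ψ_n(x-1)`. -/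
def amplitude (U : Matrix (Fin 2) (Fin 2) ℂ) (ψ₀ : ℤ → EuclideanSpace ℂ (Fin 2)) :
    ℕ → ℤ → EuclideanSpace ℂ (Fin 2)
  | 0 => ψ₀
  | n + 1 => fun x =>
      WithLp.toLp 2 (leftPart U *ᵥ (amplitude U ψ₀ n (x + 1)).ofLp
        + rightPart U *ᵥ (amplitude U ψ₀ n (x - 1)).ofLp)

/-- The Fourier transform `(2π)^{-1/2} ∑ₓ ψ(i; x) e^{ixk}`, the series converging in `L²` of the
circle `ℝ / 2πℤ`. -/
def fourierTransform (ψ : State) (i : Fin 2) :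
    Lp ℂ 2 (AddCircle.haarAddCircle (T := 2 * Real.pi)) :=
  (((√(2 * Real.pi))⁻¹ : ℝ) : ℂ) • ∑' x : ℤ, (ψ x i) • fourierLp 2 x

/-- The argument `θ₁ ∈ (-π, π]` of `l₁`. -/
def theta (U : Matrix (Fin 2) (Fin 2) ℂ) : ℝ := Complex.arg (U 0 0)

/-- The dispersion `γ(k) ∈ [0, π]` with `cos γ(k) = |l₁| cos k`. -/
def gam (U : Matrix (Fin 2) (Fin 2) ℂ) (k : ℝ) : ℝ := Real.arccos (‖U 0 0‖ * Real.cos k)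

/-- The matrix `S(k)`. Its columns are eigenvectors, for the eigenvalues `e^{iγ(k)}` and
`e^{-iγ(k)}`, of the Fourier symbol `e^{-iq} L + e^{iq} R` of the walk at `q = k + θ₁`. -/
def eigenMatrix (U : Matrix (Fin 2) (Fin 2) ℂ) (k : ℝ) : Matrix (Fin 2) (Fin 2) ℂ :=
  !![Complex.exp (-(Complex.I * k)), Complex.exp (-(Complex.I * k));
    -(Complex.exp (Complex.I * theta U) / U 0 1) *
      (‖U 0 0‖ * Complex.exp (-(Complex.I * k)) - Complex.exp (Complex.I * gam U k)),
    -(Complex.exp (Complex.I * theta U) / U 0 1) *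
      (‖U 0 0‖ * Complex.exp (-(Complex.I * k)) - Complex.exp (-(Complex.I * gam U k)))]

/-- The coordinates `S(k)⁻¹ ψ̂₀(k + θ₁)` of the initial state in the eigenbasis. -/
def eigenCoord (U : Matrix (Fin 2) (Fin 2) ℂ) (ψ₀ : State) (k : ℝ) : Fin 2 → ℂ :=
  (eigenMatrix U k)⁻¹ *ᵥ
    fun i => fourierTransform ψ₀ i ((k + theta U : ℝ) : AddCircle (2 * Real.pi))

/-- `|l_±(k)|² + |m_±(k)|²`, where `(l_±(k), m_±(k))` is the component of `ψ̂₀(k + θ₁)` along the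
eigenvector with eigenvalue `e^{± iγ(k)}` (index `s = 0` for `+`, and `s = 1` for `-`). -/
def branchWeight (U : Matrix (Fin 2) (Fin 2) ℂ) (ψ₀ : State) (s : Fin 2) (k : ℝ) : ℝ :=
  ‖eigenMatrix U k 0 s * eigenCoord U ψ₀ k s‖ ^ 2 + ‖eigenMatrix U k 1 s * eigenCoord U ψ₀ k s‖ ^ 2

/-- For `|y| < |l₁|`, the solution `c₁(y) ∈ (-π/2, π/2)` of `γ'(c) = y`. -/
def statPoint₁ (U : Matrix (Fin 2) (Fin 2) ℂ) (y : ℝ) : ℝ :=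
  Real.arcsin (√(1 - ‖U 0 0‖ ^ 2) * y / (‖U 0 0‖ * √(1 - y ^ 2)))

/-- The other solution `c₂(y) = π - c₁(y)` of `γ'(c) = y` modulo `2π`. -/
def statPoint₂ (U : Matrix (Fin 2) (Fin 2) ℂ) (y : ℝ) : ℝ := Real.pi - statPoint₁ U y

/-- The factor `g(y)` of the limit density that depends on the initial state. -/
def initialFactor (U : Matrix (Fin 2) (Fin 2) ℂ) (ψ₀ : State) (y : ℝ) : ℝ :=
  Real.pi *
    (branchWeight U ψ₀ 0 (statPoint₁ U y) + branchWeight U ψ₀ 0 (statPoint₂ U y)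
      + branchWeight U ψ₀ 1 (-statPoint₁ U y) + branchWeight U ψ₀ 1 (-statPoint₂ U y))

/-- The limit density, vanishing outside `(-|l₁|, |l₁|)`. -/
def limitDensity (U : Matrix (Fin 2) (Fin 2) ℂ) (ψ₀ : State) (y : ℝ) : ℝ :=
  (Set.Ioo (-‖U 0 0‖) ‖U 0 0‖).indicator
    (fun y => √(1 - ‖U 0 0‖ ^ 2) / (Real.pi * (1 - y ^ 2) * √(‖U 0 0‖ ^ 2 - y ^ 2))
      * initialFactor U ψ₀ y) y

end QuantumWalk

end

/-! In Fourier space one step of the walk is multiplication by the unitary symbol `e^{-iq} L +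
e^{iq} R`, with eigenvalues `e^{± iγ(k)}` at `q = k + θ₁`. When `l₂ ≠ 0` these are distinct for
every `k`, and the transformed state at time `n` is `F_n = ∑ₛ e^{inΓₛ} fₛ`, where `Γₛ = ± γ` and the
`fₛ` are the pointwise orthogonal eigencomponents of the transformed initial state
(`fourierCoeff_phaseSum`).

By Parseval the characteristic function of `X_n / n` at `ξ` is a constant times `∫ ⟪F_n(q), F_n(q +
ξ/n)⟫ dq`. Translations are continuous in `L²` and the phases are unimodular, so replacing `fₛ(q +
ξ/n)` by `fₛ(q)` costs an error tending to `0`. Orthogonality then removes the cross terms exactly,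
and what remains is `∑ₛ ∫ e^{in(Γₛ(q + ξ/n) - Γₛ(q))} ‖fₛ‖²`, which converges to `∑ₛ ∫ e^{iξΓₛ'}
‖fₛ‖²` by dominated convergence (`tendsto_integral_inner_phaseSum`). No regularity of the initial
state beyond `ℓ²` and no stationary phase estimate is needed.

The limit is the characteristic function of `limitLaw`, the image of the densities `‖fₛ‖²` under the
group velocities, so Lévy's theorem gives convergence in distribution. If `l₁ ≠ 0`, inverting `γ'`
on each half-period turns this image into the explicit density (`limitLaw_eq_withDensity`); if `l₁ =
0` the velocities vanish. If `l₂ = 0` the two chiralities decouple into translations, and the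
characteristic functions are computed in position space. -/

namespace QuantumWalk

open AddCircle ComplexConjugate

/-! ### Fourier coefficients and translations on the circle. -/

section Circle

variable {T : ℝ} [hT : Fact (0 < T)]

theorem fourierCoeff_comp_add_right (f : AddCircle T → ℂ) (t : AddCircle T) (x : ℤ) :
    fourierCoeff (fun q => f (q + t)) x = fourier x t * fourierCoeff f x := by
  have h : ∀ q : AddCircle T, fourier (-x) q • f (q + t)
      = (fun p => fourier x t * (fourier (-x) p • f p)) (q + t) := by
    intro q
    have h1 : (fourier (-x) (q + t) : ℂ) = fourier (-x) q * fourier (-x) t := by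
      simp only [fourier_apply, smul_add, toCircle_add, Circle.coe_mul]
    have h2 : (fourier x t : ℂ) * fourier (-x) t = 1 := by
      rw [← fourier_add, add_neg_cancel, fourier_zero]
    simp only [smul_eq_mul, h1]
    linear_combination -(fourier (-x) q * f (q + t)) * h2
  unfold fourierCoeff
  simp_rw [h]
  rw [integral_add_right_eq_self (μ := haarAddCircle)
    (fun p => fourier x t * (fourier (-x) p • f p)) t]
  exact integral_const_mul _ _

theorem fourierCoeff_fourier_mul (f : AddCircle T → ℂ) (m x : ℤ) :
    fourierCoeff (fun q => fourier m q * f q) x = fourierCoeff f (x - m) := by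
  unfold fourierCoeff
  congr 1 with q
  rw [smul_eq_mul, smul_eq_mul, ← mul_assoc, ← fourier_add]
  congr 3
  ring

/-- Parseval in polarised form, needed because a function is paired with its own translate. -/
theorem hasSum_conj_fourierCoeff_mul {f g : AddCircle T → ℂ} (hf : MemLp f 2 haarAddCircle)
    (hg : MemLp g 2 haarAddCircle) :
    HasSum (fun x => conj (fourierCoeff f x) * fourierCoeff g x)
      (∫ q, conj (f q) * g q ∂haarAddCircle) := by
  have h := (fourierBasis (T := T)).hasSum_inner_mul_inner (hf.toLp f) (hg.toLp g)
  have e1 : ∀ (u : AddCircle T → ℂ) (hu : MemLp u 2 haarAddCircle) (x : ℤ),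
      inner ℂ (fourierBasis (T := T) x) (hu.toLp u) = fourierCoeff u x := by
    intro u hu x
    rw [← HilbertBasis.repr_apply_apply, fourierBasis_repr]
    exact congrFun (fourierCoeff_congr_ae hu.coeFn_toLp) x
  convert! h using 1
  · funext x
    rw [← e1 f hf, ← e1 g hg, inner_conj_symm]
  · rw [L2.inner_def]
    refine integral_congr_ae ?_
    filter_upwards [hf.coeFn_toLp, hg.coeFn_toLp] with q h1 h2
    rw [h1, h2, RCLike.inner_apply']

/-- Parseval's identity for the characteristic function of the distribution `‖F̂(x)‖²`. -/
theorem hasSum_norm_sq_fourierCoeff_mul_fourier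
    {F : AddCircle T → EuclideanSpace ℂ (Fin 2)} (hF : MemLp F 2 haarAddCircle) (t : AddCircle T) :
    HasSum (fun x => ((∑ i, ‖fourierCoeff (fun q => F q i) x‖ ^ 2 : ℝ) : ℂ) * fourier x t)
      (∫ q, inner ℂ (F q) (F (q + t)) ∂haarAddCircle) := by
  have hmp : MeasurePreserving (fun q : AddCircle T => q + t) haarAddCircle haarAddCircle :=
    measurePreserving_add_right _ t
  have hF' := hF.comp_measurePreserving hmp
  have hFi : ∀ i, MemLp (fun q => F q i) 2 haarAddCircle := fun i =>
    (EuclideanSpace.proj (𝕜 := ℂ) i).comp_memLp' hF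
  have hFi' : ∀ i, MemLp (fun q => F (q + t) i) 2 haarAddCircle := fun i =>
    (EuclideanSpace.proj (𝕜 := ℂ) i).comp_memLp' hF'
  have h := hasSum_sum (s := Finset.univ)
    fun (i : Fin 2) _ => hasSum_conj_fourierCoeff_mul (hFi i) (hFi' i)
  convert! h using 1
  · funext x
    push_cast
    rw [Finset.sum_mul]
    refine Finset.sum_congr rfl fun i _ => ?_
    rw [fourierCoeff_comp_add_right (fun q => F q i), ← Complex.conj_mul']
    ring
  · rw [← integral_finsetSum]
    · refine integral_congr_ae (.of_forall fun q => ?_)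
      simp [PiLp.inner_apply, mul_comm]
    · intro i _
      exact MemLp.integrable_mul (p := 2) (q := 2) (hFi i).star (hFi' i)

/-- Continuity of translations in `L²`. -/
theorem tendsto_eLpNorm_translate_sub {E : Type*} [NormedAddCommGroup E]
    {f : AddCircle T → E} (hf : MemLp f 2 haarAddCircle) {t : ℕ → AddCircle T}
    (ht : Tendsto t atTop (𝓝 0)) :
    Tendsto (fun n => eLpNorm (fun q => f (q + t n) - f q) 2 haarAddCircle) atTop (𝓝 0) := by
  have hmp : ∀ s : AddCircle T,
      MeasurePreserving (ContinuousMap.addRight s) haarAddCircle haarAddCircle :=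
    fun s => measurePreserving_add_right _ s
  have hg : Tendsto (fun n => ContinuousMap.addRight (t n)) atTop
      (𝓝 (ContinuousMap.addRight (0 : AddCircle T))) := by
    -- Currying the jointly continuous addition makes the translation depend continuously on its
    -- parameter in the compact-open topology.
    let G : C(AddCircle T × AddCircle T, AddCircle T) :=
      ⟨fun p => p.2 + p.1, by fun_prop⟩
    exact (G.curry.continuous.tendsto 0).comp ht
  have h := Tendsto.compMeasurePreservingLp (p := 2) (tendsto_const_nhds (x := hf.toLp f)) hg
    (fun n => hmp (t n)) (hmp 0) (by simp)
  rw [tendsto_iff_edist_tendsto_0] at h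
  refine h.congr fun n => ?_
  rw [Lp.edist_def]
  refine eLpNorm_congr_ae ?_
  have key : ∀ s : AddCircle T,
      (Lp.compMeasurePreserving _ (hmp s) (hf.toLp f) : AddCircle T → E)
        =ᵐ[haarAddCircle] fun q => f (q + s) := by
    intro s
    refine (Lp.coeFn_compMeasurePreserving _ (hmp s)).trans ?_
    exact (hmp s).quasiMeasurePreserving.ae_eq_comp hf.coeFn_toLp
  filter_upwards [key (t n), key 0] with q h1 h2
  rw [Pi.sub_apply, h1, h2, add_zero]

end Circle

/-! ### The walk in Fourier space. -/

/-- The coefficients of the Fourier transform. -/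
theorem fourierCoeff_fourierTransform (ψ : State) (i : Fin 2) (x : ℤ) :
    fourierCoeff (fourierTransform ψ i) x = (((√(2 * Real.pi))⁻¹ : ℝ) : ℂ) * ψ x i := by
  have hmem : Memℓp (fun x : ℤ => ψ x i) 2 := by
    refine (lp.memℓp ψ).mono' fun x => ?_
    exact PiLp.norm_apply_le _ _
  have h := (fourierBasis (T := 2 * Real.pi)).hasSum_repr_symm ⟨_, hmem⟩
  have e : fourierTransform ψ i = (((√(2 * Real.pi))⁻¹ : ℝ) : ℂ) •
      (fourierBasis (T := 2 * Real.pi)).repr.symm ⟨_, hmem⟩ := by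
    rw [← h.tsum_eq, coe_fourierBasis]
    rfl
  rw [← fourierBasis_repr, e, map_smul, LinearIsometryEquiv.apply_symm_apply]
  rfl

/-- If `F (n + 1) = (e^{-iq} L + e^{iq} R) F n`, the Fourier coefficients of `F n` follow the walk
started at those of `F 0`. -/
theorem fourierCoeff_eq_mul_amplitude (U : Matrix (Fin 2) (Fin 2) ℂ)
    (ψ : ℤ → EuclideanSpace ℂ (Fin 2)) (c : ℂ)
    {F : ℕ → AddCircle (2 * Real.pi) → EuclideanSpace ℂ (Fin 2)}
    (hF : ∀ n, MemLp (F n) 2 haarAddCircle)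
    (h0 : ∀ i x, fourierCoeff (fun q => F 0 q i) x = c * ψ x i)
    (hl : ∀ n q, F (n + 1) q 0 = fourier (-1) q * (U 0 0 * F n q 0 + U 0 1 * F n q 1))
    (hr : ∀ n q, F (n + 1) q 1 = fourier 1 q * (U 1 0 * F n q 0 + U 1 1 * F n q 1)) (n : ℕ) :
    ∀ i x, fourierCoeff (fun q => F n q i) x = c * amplitude U ψ n x i := by
  induction n with
  | zero => exact h0
  | succ n ih =>
    have hint : ∀ i (a : ℂ), Integrable (fun q => a * F n q i) haarAddCircle := fun i a =>
      (((EuclideanSpace.proj (𝕜 := ℂ) i).comp_memLp' (hF n)).integrable (by norm_num)).const_mul a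
    have hcoef : ∀ (a b : ℂ) (x : ℤ),
        fourierCoeff (fun q => a * F n q 0 + b * F n q 1) x
          = c * (a * amplitude U ψ n x 0 + b * amplitude U ψ n x 1) := by
      intro a b x
      have := congrFun (fourierCoeff.add (hint 0 a) (hint 1 b)) x
      rw [Pi.add_apply, fourierCoeff.const_mul, fourierCoeff.const_mul, ih, ih] at this
      refine this.trans ?_
      ring
    intro i x
    fin_cases i
    · simp only [Fin.zero_eta, hl]
      rw [fourierCoeff_fourier_mul (fun q => U 0 0 * F n q 0 + U 0 1 * F n q 1), hcoef]
      simp [amplitude, leftPart, rightPart, dotProduct, Fin.sum_univ_two]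
    · simp only [Fin.mk_one, hr]
      rw [fourierCoeff_fourier_mul (fun q => U 1 0 * F n q 0 + U 1 1 * F n q 1), hcoef]
      simp [amplitude, leftPart, rightPart, dotProduct, Fin.sum_univ_two]

/-! ### Asymptotics of superpositions of orthogonal waves. -/

section Dispersion

variable {α ι : Type*} [Fintype ι] {E : Type*} [NormedAddCommGroup E] [InnerProductSpace ℂ E]

/-- A superposition of the waves `f s` with the phases `Γ s`. -/
noncomputable def phaseSum (Γ : ι → α → ℝ) (f : ι → α → E)
    (q : α) : E :=
  ∑ s, Complex.exp (Complex.I * Γ s q) • f s q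

/-- Scalar phases preserve orthogonality. The two families of phases may differ but the waves must
be evaluated at the same point; in the application `Γ'` is a translate of `Γ`. -/
theorem inner_phaseSum_of_orthogonal {Γ Γ' : ι → α → ℝ} {f : ι → α → E}
    {q : α} (horth : ∀ s s', s ≠ s' → inner ℂ (f s q) (f s' q) = 0) :
    inner ℂ (phaseSum Γ f q) (phaseSum Γ' f q)
      = ∑ s, Complex.exp (Complex.I * ((Γ' s q - Γ s q : ℝ) : ℂ)) * ((‖f s q‖ ^ 2 : ℝ) : ℂ) := by
  unfold phaseSum
  rw [sum_inner]
  refine Finset.sum_congr rfl fun s _ => ?_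
  rw [inner_sum, Finset.sum_eq_single s]
  · rw [inner_smul_left, inner_smul_right, inner_self_eq_norm_sq_to_K, ← mul_assoc,
      ← Complex.exp_conj, ← Complex.exp_add]
    congr 2
    · simp
      ring
    · simp
  · intro s' _ hs
    rw [inner_smul_left, inner_smul_right, horth s s' hs.symm, mul_zero, mul_zero]
  · simp

variable {T : ℝ} [hT : Fact (0 < T)]

theorem norm_exp_I_mul (r : ℝ) : ‖Complex.exp (Complex.I * r)‖ = 1 := by
  rw [mul_comm, Complex.norm_exp_ofReal_mul_I]

theorem memLp_exp_smul {Γ : AddCircle T → ℝ} {f : AddCircle T → E} (hΓ : Measurable Γ)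
    (hf : MemLp f 2 haarAddCircle) :
    MemLp (fun q => Complex.exp (Complex.I * Γ q) • f q) 2 haarAddCircle := by
  refine hf.congr_norm ?_ (.of_forall fun q => by rw [norm_smul, norm_exp_I_mul, one_mul])
  exact (by fun_prop : Measurable fun q => Complex.exp (Complex.I * Γ q)).aestronglyMeasurable.smul
    hf.1

theorem memLp_phaseSum {Γ : ι → AddCircle T → ℝ} {f : ι → AddCircle T → E}
    (hΓ : ∀ s, Measurable (Γ s)) (hf : ∀ s, MemLp (f s) 2 haarAddCircle) :
    MemLp (phaseSum Γ f) 2 haarAddCircle :=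
  memLp_finsetSum _ fun s _ => memLp_exp_smul (hΓ s) (hf s)

/-- The phases are unimodular, so the bound does not depend on them and is uniform in time. -/
theorem eLpNorm_phaseSum_le {Γ : ι → AddCircle T → ℝ} {f : ι → AddCircle T → E}
    (hΓ : ∀ s, Measurable (Γ s)) (hf : ∀ s, MemLp (f s) 2 haarAddCircle) :
    eLpNorm (phaseSum Γ f) 2 haarAddCircle ≤ ∑ s, eLpNorm (f s) 2 haarAddCircle := by
  have h := eLpNorm_sum_le (s := Finset.univ) (p := 2) (μ := haarAddCircle)
    (f := fun s q => Complex.exp (Complex.I * Γ s q) • f s q)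
    (fun s _ => (memLp_exp_smul (hΓ s) (hf s)).1) (by norm_num)
  have e : (∑ s, fun q => Complex.exp (Complex.I * Γ s q) • f s q) = phaseSum Γ f := by
    funext q
    rw [Finset.sum_apply]
    rfl
  rw [e] at h
  refine h.trans (Finset.sum_le_sum fun s _ => ?_)
  exact (eLpNorm_congr_norm_ae
    (.of_forall fun q => by rw [norm_smul, norm_exp_I_mul, one_mul])).le

theorem integrable_inner_of_memLp_two {f g : AddCircle T → E} (hf : MemLp f 2 haarAddCircle)
    (hg : MemLp g 2 haarAddCircle) :
    Integrable (fun q => inner ℂ (f q) (g q)) haarAddCircle := by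
  refine (L2.integrable_inner (𝕜 := ℂ) (hf.toLp f) (hg.toLp g)).congr ?_
  filter_upwards [hf.coeFn_toLp, hg.coeFn_toLp] with q h1 h2
  rw [h1, h2]

theorem norm_integral_inner_le {f g : AddCircle T → E} (hf : MemLp f 2 haarAddCircle)
    (hg : MemLp g 2 haarAddCircle) :
    ‖∫ q, inner ℂ (f q) (g q) ∂haarAddCircle‖
      ≤ (eLpNorm f 2 haarAddCircle).toReal * (eLpNorm g 2 haarAddCircle).toReal := by
  have h := norm_inner_le_norm (𝕜 := ℂ) (hf.toLp f) (hg.toLp g)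
  rw [Lp.norm_toLp, Lp.norm_toLp, L2.inner_def] at h
  convert! h using 2
  refine integral_congr_ae ?_
  filter_upwards [hf.coeFn_toLp, hg.coeFn_toLp] with q h1 h2
  rw [h1, h2]

/-- The limit of the characteristic function of a superposition of orthogonal waves: the wave
`f s` travels with the group velocity `V s`, the derivative of the phase `Γ s`. -/
theorem tendsto_integral_inner_phaseSum {Γ V : ι → AddCircle T → ℝ} {f : ι → AddCircle T → E}
    (hΓ : ∀ s, Measurable (Γ s)) (hf : ∀ s, MemLp (f s) 2 haarAddCircle)
    (horth : ∀ q s s', s ≠ s' → inner ℂ (f s q) (f s' q) = 0) (ξ : ℝ)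
    (hV : ∀ s q, Tendsto (fun n : ℕ => (n : ℝ) * (Γ s (q + ((ξ / n : ℝ) : AddCircle T)) - Γ s q))
      atTop (𝓝 (ξ * V s q))) :
    Tendsto (fun n : ℕ => ∫ q, inner ℂ (phaseSum (fun s q => n * Γ s q) f q)
        (phaseSum (fun s q => n * Γ s q) f (q + ((ξ / n : ℝ) : AddCircle T))) ∂haarAddCircle) atTop
      (𝓝 (∑ s, ∫ q, Complex.exp (Complex.I * ((ξ * V s q : ℝ) : ℂ)) * ((‖f s q‖ ^ 2 : ℝ) : ℂ)
        ∂haarAddCircle)) := by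
  set t : ℕ → AddCircle T := fun n => ((ξ / n : ℝ) : AddCircle T) with ht
  have ht0 : Tendsto t atTop (𝓝 0) := by
    have h1 : Tendsto (fun n : ℕ => ξ / n) atTop (𝓝 0) := tendsto_const_div_atTop_nhds_zero_nat ξ
    exact ((AddCircle.continuous_mk' T).tendsto 0).comp h1
  have hmp : ∀ s : AddCircle T,
      MeasurePreserving (fun q : AddCircle T => q + s) haarAddCircle haarAddCircle :=
    fun s => measurePreserving_add_right _ s
  have hΓn : ∀ (n : ℕ) s, Measurable fun q => n * Γ s q := fun n s => (hΓ s).const_mul _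
  have hΓt : ∀ (n : ℕ) s, Measurable fun q => n * Γ s (q + t n) := fun n s =>
    ((hΓ s).comp (measurable_add_const _)).const_mul _
  have hft : ∀ (n : ℕ) s, MemLp (fun q => f s (q + t n) - f s q) 2 haarAddCircle := fun n s =>
    ((hf s).comp_measurePreserving (hmp (t n))).sub (hf s)
  -- Only the waves are split as `f(q + t) = (f(q + t) - f(q)) + f(q)`; the phases stay translated.
  -- In the second part both sides carry the waves at `q`, so the cross terms vanish.
  have hsplit : ∀ n : ℕ, ∫ q, inner ℂ (phaseSum (fun s q => n * Γ s q) f q)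
        (phaseSum (fun s q => n * Γ s q) f (q + t n)) ∂haarAddCircle
      = (∫ q, inner ℂ (phaseSum (fun s q => n * Γ s q) f q)
          (phaseSum (fun s q => n * Γ s (q + t n)) (fun s q => f s (q + t n) - f s q) q)
            ∂haarAddCircle)
        + ∫ q, (∑ s, Complex.exp (Complex.I * ((n * (Γ s (q + t n) - Γ s q) : ℝ) : ℂ))
          * ((‖f s q‖ ^ 2 : ℝ) : ℂ)) ∂haarAddCircle := by
    intro n
    have h2 : ∀ q, (∑ s, Complex.exp (Complex.I * ((n * (Γ s (q + t n) - Γ s q) : ℝ) : ℂ))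
          * ((‖f s q‖ ^ 2 : ℝ) : ℂ)) = inner ℂ (phaseSum (fun s q => n * Γ s q) f q)
          (phaseSum (fun s q => n * Γ s (q + t n)) f q) := by
      intro q
      rw [inner_phaseSum_of_orthogonal (horth q)]
      simp only [mul_sub]
    simp_rw [h2]
    rw [← integral_add]
    · refine integral_congr_ae (.of_forall fun q => ?_)
      beta_reduce
      rw [← inner_add_right]
      congr 1
      simp only [phaseSum]
      rw [← Finset.sum_add_distrib]
      refine Finset.sum_congr rfl fun s _ => ?_
      rw [← smul_add, sub_add_cancel]
    · exact integrable_inner_of_memLp_two (memLp_phaseSum (hΓn n) hf)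
        (memLp_phaseSum (hΓt n) (hft n))
    · exact integrable_inner_of_memLp_two (memLp_phaseSum (hΓn n) hf)
        (memLp_phaseSum (hΓt n) hf)
  refine Tendsto.congr (fun n => (hsplit n).symm) ?_
  rw [← zero_add (∑ s, _)]
  refine Tendsto.add ?_ ?_
  -- Error term: Cauchy–Schwarz bounds it by a constant times the `L²` norms of the increments.
  · set C := ∑ s, eLpNorm (f s) 2 haarAddCircle with hC
    have hCtop : C ≠ ⊤ := ENNReal.sum_ne_top.2 fun s _ => (hf s).2.ne
    have hD : Tendsto (fun n => ∑ s, eLpNorm (fun q => f s (q + t n) - f s q) 2 haarAddCircle)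
        atTop (𝓝 0) := by
      have := tendsto_finsetSum (Finset.univ : Finset ι)
        fun s _ => tendsto_eLpNorm_translate_sub (hf s) ht0
      simpa using this
    have hD' := ((ENNReal.tendsto_toReal ENNReal.zero_ne_top).comp hD).const_mul C.toReal
    rw [ENNReal.toReal_zero, mul_zero] at hD'
    refine squeeze_zero_norm (fun n => ?_) hD'
    refine (norm_integral_inner_le (memLp_phaseSum (hΓn n) hf)
      (memLp_phaseSum (hΓt n) (hft n))).trans ?_
    refine mul_le_mul ?_ ?_ ENNReal.toReal_nonneg ENNReal.toReal_nonneg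
    · exact ENNReal.toReal_mono hCtop (eLpNorm_phaseSum_le (hΓn n) hf)
    · exact ENNReal.toReal_mono (ENNReal.sum_ne_top.2 fun s _ => (hft n s).2.ne)
        (eLpNorm_phaseSum_le (hΓt n) (hft n))
  -- Main term: dominated convergence with majorant `‖f s‖²`.
  · have hsq : ∀ s, Integrable (fun q => ‖f s q‖ ^ 2) haarAddCircle := fun s =>
      (hf s).integrable_norm_pow (by norm_num)
    have hint : ∀ (n : ℕ) s, Integrable (fun q =>
        Complex.exp (Complex.I * ((n * (Γ s (q + t n) - Γ s q) : ℝ) : ℂ))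
          * ((‖f s q‖ ^ 2 : ℝ) : ℂ)) haarAddCircle := by
      intro n s
      refine (hsq s).ofReal.bdd_mul (c := 1) ?_ (.of_forall fun q => (norm_exp_I_mul _).le)
      have hm : Measurable fun q => Γ s (q + t n) := (hΓ s).comp (measurable_add_const _)
      have hm' := hΓ s
      exact (by fun_prop : Measurable _).aestronglyMeasurable
    simp_rw [integral_finsetSum Finset.univ fun s _ => hint _ s]
    refine tendsto_finsetSum _ fun s _ => ?_
    refine tendsto_integral_of_dominated_convergence (fun q => ‖f s q‖ ^ 2)
      (fun n => (hint n s).1) (hsq s) (fun n => .of_forall fun q => ?_) (.of_forall fun q => ?_)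
    · rw [norm_mul, norm_exp_I_mul, one_mul, Complex.norm_real, Real.norm_of_nonneg (by positivity)]
    · have hc : Continuous fun r : ℝ => Complex.exp (Complex.I * (r : ℂ)) := by fun_prop
      exact ((hc.tendsto _).comp (hV s q)).mul_const _

end Dispersion

/-! ### Spectral decomposition of the Fourier symbol. -/

section Coin

variable {U : Matrix (Fin 2) (Fin 2) ℂ}

/-- Both sides are the inverse of `U`. Comparing entries expresses the second row of the coin
through the first. -/
theorem coin_adjugate (hU : U ∈ Matrix.unitaryGroup (Fin 2) ℂ) (hdet : U.det = 1) :
    U.adjugate = star U := by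
  have h1 := Matrix.mem_unitaryGroup_iff.1 hU
  calc U.adjugate = U.adjugate * (U * star U) := by rw [h1, mul_one]
    _ = star U := by rw [← mul_assoc, Matrix.adjugate_mul, hdet, one_smul, one_mul]

theorem coin_one_one (hU : U ∈ Matrix.unitaryGroup (Fin 2) ℂ) (hdet : U.det = 1) :
    U 1 1 = conj (U 0 0) := by
  have := congrFun (congrFun (coin_adjugate hU hdet) 0) 0
  simpa [Matrix.adjugate_fin_two, Matrix.star_apply] using this

theorem coin_one_zero (hU : U ∈ Matrix.unitaryGroup (Fin 2) ℂ) (hdet : U.det = 1) :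
    U 1 0 = -conj (U 0 1) := by
  have := congrFun (congrFun (coin_adjugate hU hdet) 1) 0
  simp [Matrix.adjugate_fin_two, Matrix.star_apply] at this
  rw [← this, neg_neg]

theorem coin_norm_sq (hU : U ∈ Matrix.unitaryGroup (Fin 2) ℂ) :
    ‖U 0 0‖ ^ 2 + ‖U 0 1‖ ^ 2 = 1 := by
  have h := congrFun (congrFun (Matrix.mem_unitaryGroup_iff.1 hU) 0) 0
  simp only [Matrix.mul_apply, Fin.sum_univ_two, Matrix.star_apply, Matrix.one_apply_eq,
    RCLike.star_def, Complex.mul_conj'] at h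
  exact_mod_cast h

theorem coin_norm_lt_one (hU : U ∈ Matrix.unitaryGroup (Fin 2) ℂ) (h01 : U 0 1 ≠ 0) :
    ‖U 0 0‖ < 1 := by
  have h := coin_norm_sq hU
  have h2 : 0 < ‖U 0 1‖ := norm_pos_iff.2 h01
  nlinarith [norm_nonneg (U 0 0)]

theorem abs_norm_mul_cos_lt_one (h : ‖U 0 0‖ < 1) (k : ℝ) : |‖U 0 0‖ * Real.cos k| < 1 := by
  rw [abs_mul, abs_norm]
  exact (mul_le_of_le_one_right (norm_nonneg _) (Real.abs_cos_le_one k)).trans_lt h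

theorem cos_gam (h : ‖U 0 0‖ < 1) (k : ℝ) :
    Real.cos (gam U k) = ‖U 0 0‖ * Real.cos k := by
  have := abs_lt.1 (abs_norm_mul_cos_lt_one h k)
  exact Real.cos_arccos this.1.le this.2.le

/-- The group velocity `γ'(k)`. -/
noncomputable def groupVelocity (U : Matrix (Fin 2) (Fin 2) ℂ) (k : ℝ) : ℝ :=
  ‖U 0 0‖ * Real.sin k / √(1 - (‖U 0 0‖ * Real.cos k) ^ 2)

/-- The bound `|l₁| < 1` keeps the argument of `arccos` away from `± 1`, where it is not
differentiable. -/
theorem hasDerivAt_gam (h : ‖U 0 0‖ < 1) (k : ℝ) :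
    HasDerivAt (gam U) (groupVelocity U k) k := by
  have hk := abs_lt.1 (abs_norm_mul_cos_lt_one h k)
  have h1 := (Real.hasDerivAt_arccos hk.1.ne' hk.2.ne).comp k
    ((Real.hasDerivAt_cos k).const_mul ‖U 0 0‖)
  refine h1.congr_deriv ?_
  rw [groupVelocity]
  ring

theorem gam_periodic : Function.Periodic (gam U) (2 * Real.pi) := fun k => by
  simp [gam, Real.cos_periodic k]

theorem groupVelocity_periodic : Function.Periodic (groupVelocity U) (2 * Real.pi) := fun k => by
  simp [groupVelocity, Real.cos_periodic k]

theorem eigenMatrix_periodic : Function.Periodic (eigenMatrix U) (2 * Real.pi) := fun k => by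
  have h : Complex.exp (-(Complex.I * ((k + 2 * Real.pi : ℝ) : ℂ)))
      = Complex.exp (-(Complex.I * k)) := by
    rw [← Complex.exp_periodic.sub_eq (-(Complex.I * k))]
    push_cast
    ring_nf
  simp only [eigenMatrix, h, gam_periodic k]

/-- The sign of the branch of the dispersion relation. -/
def branchSign : Fin 2 → ℝ := ![1, -1]

/-- The eigenvalue `e^{± iγ(k)}`. -/
noncomputable def eigenvalue (U : Matrix (Fin 2) (Fin 2) ℂ) (s : Fin 2) (k : ℝ) : ℂ :=
  Complex.exp (Complex.I * ((branchSign s * gam U k : ℝ) : ℂ))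

theorem eigenMatrix_zero_apply (s : Fin 2) (k : ℝ) :
    eigenMatrix U k 0 s = Complex.exp (-(Complex.I * k)) := by
  fin_cases s <;> rfl

theorem eigenMatrix_one_apply (s : Fin 2) (k : ℝ) :
    eigenMatrix U k 1 s = -(Complex.exp (Complex.I * theta U) / U 0 1) *
      (‖U 0 0‖ * Complex.exp (-(Complex.I * k)) - eigenvalue U s k) := by
  fin_cases s <;> simp [eigenMatrix, eigenvalue, branchSign]

/-- This is `2 cos γ(k)`, the trace of the symbol at `q = k + θ₁`: the shift by `θ₁` absorbs the
argument of `l₁`. With the determinant `1` it fixes the characteristic polynomial. -/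
theorem eigenvalue_zero_add_one (h : ‖U 0 0‖ < 1) (k : ℝ) :
    eigenvalue U 0 k + eigenvalue U 1 k
      = ‖U 0 0‖ * (Complex.exp (Complex.I * k) + Complex.exp (-(Complex.I * k))) := by
  have h1 := congrArg (fun r : ℝ => (2 * r : ℂ)) (cos_gam h k)
  simp only [Complex.ofReal_cos, Complex.ofReal_mul, Complex.two_cos,
    mul_left_comm (2 : ℂ)] at h1
  simp only [eigenvalue, branchSign, Matrix.cons_val_zero, Matrix.cons_val_one, one_mul,
    Complex.ofReal_mul, Complex.ofReal_neg, Complex.ofReal_one]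
  convert! h1 using 2 <;> ring_nf

theorem eigenvalue_zero_mul_one (k : ℝ) : eigenvalue U 0 k * eigenvalue U 1 k = 1 := by
  rw [eigenvalue, eigenvalue, ← Complex.exp_add, ← mul_add, ← Complex.ofReal_add]
  simp [branchSign]

theorem exp_I_mul_mul_exp_neg (k : ℂ) :
    Complex.exp (Complex.I * k) * Complex.exp (-(Complex.I * k)) = 1 := by
  rw [← Complex.exp_add, add_neg_cancel, Complex.exp_zero]

theorem coin_zero_zero_eq : U 0 0 = ‖U 0 0‖ * Complex.exp (Complex.I * theta U) := by
  rw [mul_comm Complex.I, theta, Complex.norm_mul_exp_arg_mul_I]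

theorem conj_exp_I_mul (r : ℝ) :
    conj (Complex.exp (Complex.I * r)) = Complex.exp (-(Complex.I * r)) := by
  rw [← Complex.exp_conj]
  simp

theorem conj_eigenvalue_zero (k : ℝ) : conj (eigenvalue U 0 k) = eigenvalue U 1 k := by
  rw [eigenvalue, conj_exp_I_mul]
  simp [eigenvalue, branchSign]

/-- The eigenvalues are conjugate, so equality would make them real; but `γ(k)` lies strictly inside
`(0, π)`, hence `sin γ(k) > 0`. -/
theorem eigenvalue_zero_ne_one (h : ‖U 0 0‖ < 1) (k : ℝ) :
    eigenvalue U 0 k ≠ eigenvalue U 1 k := by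
  intro he
  rw [← conj_eigenvalue_zero] at he
  have him : (eigenvalue U 0 k).im = 0 := by
    have := congrArg Complex.im he
    simp only [Complex.conj_im] at this
    linarith
  have hk := abs_lt.1 (abs_norm_mul_cos_lt_one h k)
  have hs : (eigenvalue U 0 k).im = Real.sin (gam U k) := by
    simp [eigenvalue, branchSign, Complex.exp_im]
  have : 0 < Real.sin (gam U k) := by
    rw [gam, Real.sin_arccos]
    apply Real.sqrt_pos.2
    nlinarith
  linarith

theorem det_eigenMatrix_ne_zero (h : ‖U 0 0‖ < 1) (h01 : U 0 1 ≠ 0) (k : ℝ) :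
    (eigenMatrix U k).det ≠ 0 := by
  have hd : (eigenMatrix U k).det = Complex.exp (-(Complex.I * k)) *
      (Complex.exp (Complex.I * theta U) / U 0 1) * (eigenvalue U 1 k - eigenvalue U 0 k) := by
    rw [Matrix.det_fin_two]
    simp only [eigenMatrix_zero_apply, eigenMatrix_one_apply]
    ring
  rw [hd]
  exact mul_ne_zero (mul_ne_zero (Complex.exp_ne_zero _)
    (div_ne_zero (Complex.exp_ne_zero _) h01)) (sub_ne_zero.2 (eigenvalue_zero_ne_one h k).symm)

theorem fourier_neg_one_coe (k θ : ℝ) :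
    (fourier (-1) ((k + θ : ℝ) : AddCircle (2 * Real.pi)) : ℂ)
      = Complex.exp (-(Complex.I * k)) * Complex.exp (-(Complex.I * θ)) := by
  rw [fourier_coe_apply, ← Complex.exp_add]
  congr 1
  have : (Real.pi : ℂ) ≠ 0 := by exact_mod_cast Real.pi_ne_zero
  push_cast
  field_simp
  ring

theorem fourier_one_coe (k θ : ℝ) :
    (fourier 1 ((k + θ : ℝ) : AddCircle (2 * Real.pi)) : ℂ)
      = Complex.exp (Complex.I * k) * Complex.exp (Complex.I * θ) := by
  rw [fourier_coe_apply, ← Complex.exp_add]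
  congr 1
  have : (Real.pi : ℂ) ≠ 0 := by exact_mod_cast Real.pi_ne_zero
  push_cast
  field_simp

/-- The first row of the eigenvector equation for the symbol `e^{-iq} L + e^{iq} R`. -/
theorem eigenMatrix_eigen_zero (h01 : U 0 1 ≠ 0) (s : Fin 2) (k : ℝ) :
    eigenvalue U s k * eigenMatrix U k 0 s
      = fourier (-1) ((k + theta U : ℝ) : AddCircle (2 * Real.pi)) *
        (U 0 0 * eigenMatrix U k 0 s + U 0 1 * eigenMatrix U k 1 s) := by
  rw [fourier_neg_one_coe, eigenMatrix_zero_apply, eigenMatrix_one_apply]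
  have h0 := coin_zero_zero_eq (U := U)
  have h1 := exp_I_mul_mul_exp_neg (theta U)
  set τ := Complex.exp (Complex.I * theta U)
  set τ' := Complex.exp (-(Complex.I * theta U))
  set z := Complex.exp (-(Complex.I * k))
  set l := eigenvalue U s k
  have h2 : U 0 1 * (-(τ / U 0 1) * (‖U 0 0‖ * z - l)) = -τ * (‖U 0 0‖ * z - l) := by
    field_simp
  rw [h2, show U 0 0 * z = ‖U 0 0‖ * τ * z by rw [← h0]]
  linear_combination -(z * l) * h1

theorem eigenvalue_quadratic (h : ‖U 0 0‖ < 1) (s : Fin 2) (k : ℝ) :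
    eigenvalue U s k ^ 2 + 1 = ‖U 0 0‖ *
      (Complex.exp (Complex.I * k) + Complex.exp (-(Complex.I * k))) * eigenvalue U s k := by
  rw [← eigenvalue_zero_add_one h]
  have := eigenvalue_zero_mul_one (U := U) k
  fin_cases s
  · simp only [Fin.zero_eta]
    linear_combination -this
  · simp only [Fin.mk_one]
    linear_combination -this

/-- The second row of the eigenvector equation for the symbol `e^{-iq} L + e^{iq} R`. -/
theorem eigenMatrix_eigen_one (hU : U ∈ Matrix.unitaryGroup (Fin 2) ℂ) (hdet : U.det = 1)
    (h01 : U 0 1 ≠ 0) (s : Fin 2) (k : ℝ) :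
    eigenvalue U s k * eigenMatrix U k 1 s
      = fourier 1 ((k + theta U : ℝ) : AddCircle (2 * Real.pi)) *
        (U 1 0 * eigenMatrix U k 0 s + U 1 1 * eigenMatrix U k 1 s) := by
  rw [fourier_one_coe, eigenMatrix_zero_apply, eigenMatrix_one_apply]
  have hq := eigenvalue_quadratic (coin_norm_lt_one hU h01) s k
  have hn : (‖U 0 0‖ : ℂ) ^ 2 + ‖U 0 1‖ ^ 2 = 1 := by exact_mod_cast coin_norm_sq hU
  have h10 : U 0 1 * U 1 0 = -(‖U 0 1‖ : ℂ) ^ 2 := by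
    rw [coin_one_zero hU hdet, mul_neg, Complex.mul_conj']
  have h11 : U 1 1 = ‖U 0 0‖ * Complex.exp (-(Complex.I * theta U)) := by
    rw [coin_one_one hU hdet]
    conv_lhs => rw [coin_zero_zero_eq (U := U)]
    rw [map_mul, Complex.conj_ofReal, conj_exp_I_mul]
  have h1 := exp_I_mul_mul_exp_neg (theta U)
  have h2 := exp_I_mul_mul_exp_neg k
  rw [h11]
  set τ := Complex.exp (Complex.I * theta U)
  set τ' := Complex.exp (-(Complex.I * theta U))
  set z := Complex.exp (-(Complex.I * k))
  set w := Complex.exp (Complex.I * k)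
  set l := eigenvalue U s k
  set a : ℂ := ((‖U 0 0‖ : ℝ) : ℂ)
  set b : ℂ := ((‖U 0 1‖ : ℝ) : ℂ)
  -- Multiplying by `l₂` clears the denominators and leaves a polynomial identity modulo the
  -- characteristic equation and `|l₁|² + |l₂|² = 1`.
  apply mul_left_cancel₀ h01
  have e1 : U 0 1 * (l * (-(τ / U 0 1) * (a * z - l))) = -τ * l * (a * z - l) := by
    field_simp
  have e2 : U 0 1 * (w * τ * (U 1 0 * z + a * τ' * (-(τ / U 0 1) * (a * z - l))))
      = w * τ * (U 0 1 * U 1 0 * z - a * (τ * τ') * (a * z - l)) := by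
    field_simp
    ring
  rw [e1, e2, h10, h1]
  linear_combination τ * hq + τ * (b ^ 2 + a ^ 2) * h2 + τ * hn

/-- Eigenvectors of a unitary matrix for distinct eigenvalues are orthogonal. Here it is a direct
computation: with `l' = conj l`, the numerator is `|l₂|² + |l₁|² - (l + l') l' + l'² = 1 - l l' =
0`. -/
theorem eigenMatrix_orthogonal (hU : U ∈ Matrix.unitaryGroup (Fin 2) ℂ) (h01 : U 0 1 ≠ 0)
    (k : ℝ) :
    conj (eigenMatrix U k 0 0) * eigenMatrix U k 0 1
      + conj (eigenMatrix U k 1 0) * eigenMatrix U k 1 1 = 0 := by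
  have hs := eigenvalue_zero_add_one (coin_norm_lt_one hU h01) k
  have hp := eigenvalue_zero_mul_one (U := U) k
  have hn : (‖U 0 0‖ : ℂ) ^ 2 + ‖U 0 1‖ ^ 2 = 1 := by exact_mod_cast coin_norm_sq hU
  have hb : conj (U 0 1) * U 0 1 = (‖U 0 1‖ : ℂ) ^ 2 := Complex.conj_mul' _
  have hb0 : conj (U 0 1) ≠ 0 := by simpa using h01
  have h1 := exp_I_mul_mul_exp_neg (theta U)
  have h2 := exp_I_mul_mul_exp_neg k
  have hz : conj (Complex.exp (-(Complex.I * k))) = Complex.exp (Complex.I * k) := by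
    rw [← conj_exp_I_mul, Complex.conj_conj]
  simp only [eigenMatrix_zero_apply, eigenMatrix_one_apply, map_mul, map_neg, map_sub, map_div₀,
    hz, conj_exp_I_mul, Complex.conj_ofReal, conj_eigenvalue_zero]
  set τ := Complex.exp (Complex.I * theta U)
  set τ' := Complex.exp (-(Complex.I * theta U))
  set z := Complex.exp (-(Complex.I * k))
  set w := Complex.exp (Complex.I * k)
  set l := eigenvalue U 0 k
  set l' := eigenvalue U 1 k
  set a : ℂ := ((‖U 0 0‖ : ℝ) : ℂ)
  set b : ℂ := ((‖U 0 1‖ : ℝ) : ℂ)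
  have e : w * z + -(τ' / conj (U 0 1)) * (a * w - l') * (-(τ / U 0 1) * (a * z - l'))
      = (conj (U 0 1) * U 0 1 * (w * z) + τ * τ' * ((a * w - l') * (a * z - l')))
        / (conj (U 0 1) * U 0 1) := by
    field_simp
  rw [e, hb, h1, h2, div_eq_zero_iff]
  left
  linear_combination a ^ 2 * h2 + l' * hs - hp + hn

end Coin

/-! ### Eigencomponents on the circle and the limit of the characteristic functions. -/

section Lift

variable {U : Matrix (Fin 2) (Fin 2) ℂ} {ψ : State}

/-- The summand at `x` of the characteristic function of `X_n / n`. -/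
noncomputable def charTerm (U : Matrix (Fin 2) (Fin 2) ℂ) (ψ : ℤ → EuclideanSpace ℂ (Fin 2))
    (n : ℕ) (ξ : ℝ) (x : ℤ) : ℂ :=
  ((‖amplitude U ψ n x‖ ^ 2 : ℝ) : ℂ) * Complex.exp (Complex.I * ((ξ * (x / n) : ℝ) : ℂ))

theorem eigenCoord_periodic : Function.Periodic (eigenCoord U ψ) (2 * Real.pi) := fun k => by
  simp only [eigenCoord, eigenMatrix_periodic k]
  have : ((k + 2 * Real.pi + theta U : ℝ) : AddCircle (2 * Real.pi))
      = ((k + theta U : ℝ) : AddCircle (2 * Real.pi)) := by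
    rw [add_right_comm]
    exact AddCircle.coe_add_period _ _
  rw [this]

/-- The component of `ψ̂₀(k + θ₁)` along the eigenvector of the branch `s`. -/
noncomputable def branchComponent (U : Matrix (Fin 2) (Fin 2) ℂ) (ψ : State) (s : Fin 2) (k : ℝ) :
    EuclideanSpace ℂ (Fin 2) :=
  WithLp.toLp 2 fun i => eigenMatrix U k i s * eigenCoord U ψ k s

theorem branchComponent_periodic (s : Fin 2) :
    Function.Periodic (branchComponent U ψ s) (2 * Real.pi) := fun k => by
  simp only [branchComponent, eigenMatrix_periodic k, eigenCoord_periodic k]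

theorem norm_branchComponent_sq (s : Fin 2) (k : ℝ) :
    ‖branchComponent U ψ s k‖ ^ 2 = branchWeight U ψ s k := by
  rw [EuclideanSpace.norm_sq_eq, Fin.sum_univ_two]
  rfl

/-- The branch component at the wave number `q = k + θ₁` of the circle. -/
noncomputable def circleComponent (U : Matrix (Fin 2) (Fin 2) ℂ) (ψ : State) (s : Fin 2) :
    AddCircle (2 * Real.pi) → EuclideanSpace ℂ (Fin 2) :=
  ((branchComponent_periodic (U := U) (ψ := ψ) s).sub_const (theta U)).lift

/-- The phase `±γ(k)` at the wave number `q = k + θ₁` of the circle. -/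
noncomputable def circlePhase (U : Matrix (Fin 2) (Fin 2) ℂ) (s : Fin 2) :
    AddCircle (2 * Real.pi) → ℝ := fun q =>
  branchSign s * ((gam_periodic (U := U)).sub_const (theta U)).lift q

/-- The velocity `±γ'(k)` at the wave number `q = k + θ₁` of the circle. -/
noncomputable def circleVelocity (U : Matrix (Fin 2) (Fin 2) ℂ) (s : Fin 2) :
    AddCircle (2 * Real.pi) → ℝ := fun q =>
  branchSign s * ((groupVelocity_periodic (U := U)).sub_const (theta U)).lift q

theorem circleComponent_coe (s : Fin 2) (k : ℝ) :
    circleComponent U ψ s ((k + theta U : ℝ) : AddCircle (2 * Real.pi))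
      = branchComponent U ψ s k := by
  rw [circleComponent, Function.Periodic.lift_coe, add_sub_cancel_right]

theorem circlePhase_coe (s : Fin 2) (k : ℝ) :
    circlePhase U s ((k + theta U : ℝ) : AddCircle (2 * Real.pi)) = branchSign s * gam U k := by
  rw [circlePhase, Function.Periodic.lift_coe, add_sub_cancel_right]

theorem circleVelocity_coe (s : Fin 2) (k : ℝ) :
    circleVelocity U s ((k + theta U : ℝ) : AddCircle (2 * Real.pi))
      = branchSign s * groupVelocity U k := by
  rw [circleVelocity, Function.Periodic.lift_coe, add_sub_cancel_right]

/-- Lets identities between lifted functions be checked on real representatives in the variable `k =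
q - θ₁`. -/
theorem exists_coe_add_eq (θ : ℝ) (q : AddCircle (2 * Real.pi)) :
    ∃ k : ℝ, q = ((k + θ : ℝ) : AddCircle (2 * Real.pi)) := by
  obtain ⟨x, rfl⟩ := QuotientAddGroup.mk_surjective q
  exact ⟨x - θ, by rw [sub_add_cancel]⟩

theorem measurable_gam : Measurable (gam U) := by
  unfold gam
  exact Real.measurable_arccos.comp (by fun_prop)

theorem measurable_groupVelocity : Measurable (groupVelocity U) := by
  unfold groupVelocity
  fun_prop

theorem measurable_eigenMatrix_apply (i s : Fin 2) :
    Measurable fun k => eigenMatrix U k i s := by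
  have := measurable_gam (U := U)
  fin_cases i <;> fin_cases s <;> simp [eigenMatrix] <;> fun_prop

theorem measurable_eigenCoord (s : Fin 2) : Measurable fun k => eigenCoord U ψ k s := by
  have hE := measurable_eigenMatrix_apply (U := U)
  have hf : ∀ i, Measurable fun k : ℝ =>
      fourierTransform ψ i ((k + theta U : ℝ) : AddCircle (2 * Real.pi)) := fun i =>
    ((Lp.stronglyMeasurable (fourierTransform ψ i)).measurable.comp
      AddCircle.measurable_mk').comp (measurable_add_const (theta U))
  have h00 := hE 0 0
  have h01 := hE 0 1
  have h10 := hE 1 0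
  have h11 := hE 1 1
  have f0 := hf 0
  have f1 := hf 1
  fin_cases s <;>
  · simp only [eigenCoord, Matrix.inv_def, Matrix.adjugate_fin_two, Matrix.det_fin_two,
      Matrix.mulVec, dotProduct, Fin.sum_univ_two, Ring.inverse_eq_inv, Matrix.smul_apply,
      smul_eq_mul, Fin.zero_eta, Fin.mk_one, Matrix.of_apply, Matrix.cons_val_zero,
      Matrix.cons_val_one]
    fun_prop

theorem measurable_branchComponent (s : Fin 2) : Measurable (branchComponent U ψ s) := by
  have h := measurable_eigenCoord (U := U) (ψ := ψ) s
  refine (WithLp.measurable_toLp 2 _).comp (measurable_pi_lambda _ fun i => ?_)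
  exact (measurable_eigenMatrix_apply i s).mul h

theorem measurable_periodic_lift {α : Type*} [MeasurableSpace α] {f : ℝ → α} {T : ℝ}
    (hf : Measurable f) (hp : Function.Periodic f T) :
    Measurable (hp.lift : AddCircle T → α) :=
  measurable_from_quotient.2 hf

theorem measurable_circleComponent (s : Fin 2) : Measurable (circleComponent U ψ s) :=
  measurable_periodic_lift ((measurable_branchComponent s).comp (measurable_sub_const _)) _

theorem measurable_circlePhase (s : Fin 2) : Measurable (circlePhase U s) :=
  (measurable_periodic_lift (measurable_gam.comp (measurable_sub_const _)) _).const_mul _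

theorem measurable_circleVelocity (s : Fin 2) : Measurable (circleVelocity U s) :=
  (measurable_periodic_lift (measurable_groupVelocity.comp (measurable_sub_const _)) _).const_mul _

theorem tendsto_circlePhase (h : ‖U 0 0‖ < 1) (ξ : ℝ) (s : Fin 2) (q : AddCircle (2 * Real.pi)) :
    Tendsto (fun n : ℕ => (n : ℝ) * (circlePhase U s (q + ((ξ / n : ℝ) : AddCircle _))
      - circlePhase U s q)) atTop (𝓝 (ξ * circleVelocity U s q)) := by
  obtain ⟨k, rfl⟩ := exists_coe_add_eq (theta U) q
  -- Differentiating in `t = 1/n` rather than in `ξ/n` covers `ξ = 0` as well.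
  have hd : HasDerivAt (fun t : ℝ => gam U (k + ξ * t)) (ξ * groupVelocity U k) 0 := by
    have h0 : HasDerivAt (fun t : ℝ => k + ξ * t) ξ 0 := by
      simpa using ((hasDerivAt_id (0 : ℝ)).const_mul ξ).const_add k
    have h1 : HasDerivAt (gam U) (groupVelocity U k) (k + ξ * 0) := by
      simpa using hasDerivAt_gam h k
    exact (h1.comp 0 h0).congr_deriv (mul_comm _ _)
  have h2 : Tendsto (fun n : ℕ => ((n : ℝ))⁻¹) atTop (𝓝[≠] 0) :=
    tendsto_nhdsWithin_iff.2 ⟨tendsto_inv_atTop_nhds_zero_nat, by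
      filter_upwards [eventually_gt_atTop 0] with n hn
      simpa using hn.ne'⟩
  have h3 := ((hasDerivAt_iff_tendsto_slope_zero.1 hd).comp h2).const_mul (branchSign s)
  rw [circleVelocity_coe, mul_left_comm]
  refine h3.congr fun n => ?_
  have : ((k + theta U : ℝ) : AddCircle (2 * Real.pi)) + ((ξ / n : ℝ) : AddCircle _)
      = ((k + ξ * (n : ℝ)⁻¹ + theta U : ℝ) : AddCircle (2 * Real.pi)) := by
    rw [← AddCircle.coe_add, add_right_comm, div_eq_mul_inv]
  rw [this, circlePhase_coe, circlePhase_coe]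
  simp
  ring

theorem sum_branchComponent (h : ‖U 0 0‖ < 1) (h01 : U 0 1 ≠ 0) (k : ℝ) (i : Fin 2) :
    (∑ s, branchComponent U ψ s k i)
      = fourierTransform ψ i ((k + theta U : ℝ) : AddCircle (2 * Real.pi)) := by
  have hinv := Matrix.mul_nonsing_inv (eigenMatrix U k)
    (isUnit_iff_ne_zero.2 (det_eigenMatrix_ne_zero h h01 k))
  have : (eigenMatrix U k *ᵥ eigenCoord U ψ k) i
      = fourierTransform ψ i ((k + theta U : ℝ) : AddCircle (2 * Real.pi)) := by
    rw [eigenCoord, Matrix.mulVec_mulVec, hinv, Matrix.one_mulVec]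
  rw [← this]
  rfl

theorem branchComponent_orthogonal (hU : U ∈ Matrix.unitaryGroup (Fin 2) ℂ) (h01 : U 0 1 ≠ 0)
    (k : ℝ) : inner ℂ (branchComponent U ψ 0 k) (branchComponent U ψ 1 k) = 0 := by
  have h := eigenMatrix_orthogonal hU h01 k
  simp only [PiLp.inner_apply, Fin.sum_univ_two, RCLike.inner_apply', branchComponent, map_mul]
  linear_combination conj (eigenCoord U ψ k 0) * eigenCoord U ψ k 1 * h

theorem circleComponent_orthogonal (hU : U ∈ Matrix.unitaryGroup (Fin 2) ℂ) (h01 : U 0 1 ≠ 0)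
    (q : AddCircle (2 * Real.pi)) (s s' : Fin 2) (hs : s ≠ s') :
    inner ℂ (circleComponent U ψ s q) (circleComponent U ψ s' q) = 0 := by
  obtain ⟨k, rfl⟩ := exists_coe_add_eq (theta U) q
  have h := branchComponent_orthogonal (ψ := ψ) hU h01 k
  simp only [circleComponent_coe]
  fin_cases s <;> fin_cases s'
  · exact absurd rfl hs
  · exact h
  · exact inner_eq_zero_symm.1 h
  · exact absurd rfl hs

theorem sum_circleComponent (h : ‖U 0 0‖ < 1) (h01 : U 0 1 ≠ 0) (q : AddCircle (2 * Real.pi))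
    (i : Fin 2) : (∑ s, circleComponent U ψ s q i) = fourierTransform ψ i q := by
  obtain ⟨k, rfl⟩ := exists_coe_add_eq (theta U) q
  simp only [circleComponent_coe]
  exact sum_branchComponent h h01 k i

theorem sum_norm_sq_circleComponent (hU : U ∈ Matrix.unitaryGroup (Fin 2) ℂ) (h01 : U 0 1 ≠ 0)
    (q : AddCircle (2 * Real.pi)) :
    ∑ s, ‖circleComponent U ψ s q‖ ^ 2 = ∑ i, ‖fourierTransform ψ i q‖ ^ 2 := by
  have h := norm_add_sq_eq_norm_sq_add_norm_sq_of_inner_eq_zero (𝕜 := ℂ) _ _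
    (circleComponent_orthogonal (ψ := ψ) hU h01 q 0 1 (by decide))
  rw [Fin.sum_univ_two, sq, sq, ← h, ← sq, EuclideanSpace.norm_sq_eq]
  refine Finset.sum_congr rfl fun i _ => ?_
  rw [← sum_circleComponent (coin_norm_lt_one hU h01) h01, Fin.sum_univ_two]
  rfl

/-- Orthogonality makes each component pointwise no longer than the transformed initial state, so no
bound on `S(k)⁻¹` is needed. -/
theorem memLp_circleComponent (hU : U ∈ Matrix.unitaryGroup (Fin 2) ℂ) (h01 : U 0 1 ≠ 0)
    (s : Fin 2) : MemLp (circleComponent U ψ s) 2 haarAddCircle := by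
  refine MemLp.mono' (((Lp.memLp (fourierTransform ψ 0)).norm).add
    (Lp.memLp (fourierTransform ψ 1)).norm)
    (measurable_circleComponent s).aestronglyMeasurable (.of_forall fun q => ?_)
  have h := sum_norm_sq_circleComponent (ψ := ψ) hU h01 q
  have h1 : ‖circleComponent U ψ s q‖ ^ 2 ≤ ∑ i, ‖fourierTransform ψ i q‖ ^ 2 := by
    rw [← h]
    exact Finset.single_le_sum (f := fun s => ‖circleComponent U ψ s q‖ ^ 2)
      (fun _ _ => by positivity) (Finset.mem_univ s)
  rw [Fin.sum_univ_two] at h1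
  refine abs_le_of_sq_le_sq' (h1.trans ?_) (by simp only [Pi.add_apply]; positivity) |>.2
  simp only [Pi.add_apply]
  nlinarith [norm_nonneg (fourierTransform ψ 0 q), norm_nonneg (fourierTransform ψ 1 q)]

theorem phaseSum_circle_zero (n : ℕ) (q : AddCircle (2 * Real.pi)) (i : Fin 2) :
    phaseSum (fun s q => n * circlePhase U s q) (circleComponent U ψ) q i
      = ∑ s, Complex.exp (Complex.I * ((n * circlePhase U s q : ℝ) : ℂ))
        * circleComponent U ψ s q i := by
  simp [phaseSum]

/-- At time `0` the components add up to the transformed initial state, and each unit of time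
multiplies a component by its eigenvalue, which is the action of the symbol. -/
theorem fourierCoeff_phaseSum (hU : U ∈ Matrix.unitaryGroup (Fin 2) ℂ) (hdet : U.det = 1)
    (h01 : U 0 1 ≠ 0) (n : ℕ) (i : Fin 2) (x : ℤ) :
    fourierCoeff (fun q => phaseSum (fun s q => n * circlePhase U s q) (circleComponent U ψ) q i) x
      = (((√(2 * Real.pi))⁻¹ : ℝ) : ℂ) * amplitude U ψ n x i := by
  have hexp : ∀ (n : ℕ) s k, Complex.exp (Complex.I *
      ((((n + 1 : ℕ) : ℝ) * (branchSign s * gam U k) : ℝ) : ℂ))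
      = Complex.exp (Complex.I * ((n * (branchSign s * gam U k) : ℝ) : ℂ)) * eigenvalue U s k := by
    intro n s k
    rw [eigenvalue, ← Complex.exp_add]
    congr 1
    push_cast
    ring
  refine fourierCoeff_eq_mul_amplitude U ψ _
    (F := fun n => phaseSum (fun s q => n * circlePhase U s q) (circleComponent U ψ)) ?_ ?_ ?_ ?_
    n i x
  · exact fun n => memLp_phaseSum (fun s => (measurable_circlePhase s).const_mul _)
      (memLp_circleComponent hU h01)
  · intro i x
    rw [← fourierCoeff_fourierTransform]
    congr 1 with q
    rw [phaseSum_circle_zero, ← sum_circleComponent (coin_norm_lt_one hU h01) h01]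
    simp
  · intro n q
    obtain ⟨k, rfl⟩ := exists_coe_add_eq (theta U) q
    simp only [phaseSum_circle_zero, circlePhase_coe, circleComponent_coe, hexp, branchComponent,
      Fin.sum_univ_two]
    have e0 := eigenMatrix_eigen_zero (U := U) h01 0 k
    have e1 := eigenMatrix_eigen_zero (U := U) h01 1 k
    linear_combination
      Complex.exp (Complex.I * ((n * (branchSign 0 * gam U k) : ℝ) : ℂ)) * eigenCoord U ψ k 0 * e0
      + Complex.exp (Complex.I * ((n * (branchSign 1 * gam U k) : ℝ) : ℂ)) * eigenCoord U ψ k 1 * e1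
  · intro n q
    obtain ⟨k, rfl⟩ := exists_coe_add_eq (theta U) q
    simp only [phaseSum_circle_zero, circlePhase_coe, circleComponent_coe, hexp, branchComponent,
      Fin.sum_univ_two]
    have e0 := eigenMatrix_eigen_one hU hdet h01 0 k
    have e1 := eigenMatrix_eigen_one hU hdet h01 1 k
    linear_combination
      Complex.exp (Complex.I * ((n * (branchSign 0 * gam U k) : ℝ) : ℂ)) * eigenCoord U ψ k 0 * e0
      + Complex.exp (Complex.I * ((n * (branchSign 1 * gam U k) : ℝ) : ℂ)) * eigenCoord U ψ k 1 * e1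

theorem hasSum_charTerm (hU : U ∈ Matrix.unitaryGroup (Fin 2) ℂ) (hdet : U.det = 1)
    (h01 : U 0 1 ≠ 0) (n : ℕ) (ξ : ℝ) :
    HasSum (charTerm U ψ n ξ) ((2 * Real.pi : ℝ) *
      ∫ q, inner ℂ (phaseSum (fun s q => n * circlePhase U s q) (circleComponent U ψ) q)
        (phaseSum (fun s q => n * circlePhase U s q) (circleComponent U ψ)
          (q + ((ξ / n : ℝ) : AddCircle (2 * Real.pi)))) ∂haarAddCircle) := by
  have h := (hasSum_norm_sq_fourierCoeff_mul_fourier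
    (memLp_phaseSum (fun s => (measurable_circlePhase (U := U) s).const_mul (n : ℝ))
      (memLp_circleComponent (ψ := ψ) hU h01))
    ((ξ / n : ℝ) : AddCircle (2 * Real.pi))).mul_left ((2 * Real.pi : ℝ) : ℂ)
  convert! h using 2 with x
  rw [charTerm, ← mul_assoc, ← Complex.ofReal_mul]
  congr 2
  · simp only [fourierCoeff_phaseSum hU hdet h01, norm_mul, mul_pow]
    rw [← Finset.mul_sum, ← EuclideanSpace.norm_sq_eq, ← mul_assoc]
    have : (2 * Real.pi) * ‖(((√(2 * Real.pi))⁻¹ : ℝ) : ℂ)‖ ^ 2 = 1 := by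
      rw [Complex.norm_real, Real.norm_eq_abs, sq_abs, inv_pow, Real.sq_sqrt Real.two_pi_pos.le,
        mul_inv_cancel₀ Real.two_pi_pos.ne']
    rw [this, one_mul]
  · beta_reduce
    rw [div_self Real.two_pi_pos.ne', one_mul, zsmul_eq_mul, mul_comm Complex.I, mul_div_left_comm]

/-- The limit of the characteristic functions when the coin is not diagonal. -/
theorem tendsto_tsum_charTerm (hU : U ∈ Matrix.unitaryGroup (Fin 2) ℂ) (hdet : U.det = 1)
    (h01 : U 0 1 ≠ 0) (ξ : ℝ) :
    Tendsto (fun n => ∑' x, charTerm U ψ n ξ x) atTop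
      (𝓝 (∑ s, ∫ q, Complex.exp (Complex.I * ((ξ * circleVelocity U s q : ℝ) : ℂ))
        * ((‖circleComponent U ψ s q‖ ^ 2 : ℝ) : ℂ))) := by
  have h := (tendsto_integral_inner_phaseSum measurable_circlePhase
    (memLp_circleComponent (ψ := ψ) hU h01) (circleComponent_orthogonal hU h01) ξ
    (tendsto_circlePhase (coin_norm_lt_one hU h01) ξ)).const_mul ((2 * Real.pi : ℝ) : ℂ)
  -- The factor `2π` left by the normalisation of the transform turns the Haar probability into
  -- Lebesgue measure on the circle.
  simp_rw [integral_haarAddCircle (f := fun q => Complex.exp _ * _)] at h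
  rw [← Finset.smul_sum, Complex.real_smul, ← mul_assoc, ← Complex.ofReal_mul,
    mul_inv_cancel₀ Real.two_pi_pos.ne', Complex.ofReal_one, one_mul] at h
  exact h.congr fun n => ((hasSum_charTerm hU hdet h01 n ξ).tsum_eq).symm

end Lift

/-! ### From characteristic functions to limit laws. -/

section Law

variable {U : Matrix (Fin 2) (Fin 2) ℂ} {ψ : State}

theorem charFun_eq_integral_exp (ν : Measure ℝ) (ξ : ℝ) :
    charFun ν ξ = ∫ y, Complex.exp (Complex.I * ((ξ * y : ℝ) : ℂ)) ∂ν := by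
  rw [charFun_apply_real]
  congr 1 with y
  rw [mul_comm Complex.I]
  push_cast
  rfl

theorem integrable_exp_I_mul (ν : Measure ℝ) [IsFiniteMeasure ν] (ξ : ℝ) :
    Integrable (fun y : ℝ => Complex.exp (Complex.I * ((ξ * y : ℝ) : ℂ))) ν :=
  Integrable.of_bound (by fun_prop : Measurable _).aestronglyMeasurable 1
    (.of_forall fun _ => (norm_exp_I_mul _).le)

/-- Lévy's continuity theorem for the rescaled positions of the walk. -/
theorem tendstoInDistribution_of_tendsto_tsum_charTerm {ψ : ℤ → EuclideanSpace ℂ (Fin 2)}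
    (ν : Measure ℝ) [IsProbabilityMeasure ν]
    (h : ∀ ξ, Tendsto (fun n => ∑' x, charTerm U ψ n ξ x) atTop (𝓝 (charFun ν ξ)))
    (Ω : ℕ → Type*) [∀ n, MeasurableSpace (Ω n)] (P : ∀ n, Measure (Ω n))
    [∀ n, IsProbabilityMeasure (P n)] (X : ∀ n, Ω n → ℤ) (hX : ∀ n, Measurable (X n))
    (hP : ∀ n x, P n {ω | X n ω = x} = ENNReal.ofReal (‖amplitude U ψ n x‖ ^ 2)) :
    TendstoInDistribution (fun n ω => (X n ω : ℝ) / n) atTop (id : ℝ → ℝ) P ν where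
  forall_aemeasurable n := by
    have := hX n
    have h2 : Measurable (Int.cast : ℤ → ℝ) := measurable_from_top
    exact ((h2.comp this).div_const _).aemeasurable
  aemeasurable_limit := aemeasurable_id
  tendsto := by
    refine ProbabilityMeasure.tendsto_iff_tendsto_charFun.2 fun ξ => ?_
    simp only [ProbabilityMeasure.coe_mk, Measure.map_id]
    refine (h ξ).congr fun n => ?_
    have hm : Measurable fun x : ℤ => (x : ℝ) / n := measurable_from_top
    -- Factoring the law through the countable space `ℤ` turns the characteristic function into a
    -- sum over sites.
    have e : (P n).map (fun ω => (X n ω : ℝ) / n) = ((P n).map (X n)).map fun x : ℤ => (x : ℝ) / n :=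
      (Measure.map_map hm (hX n)).symm
    have := Measure.isProbabilityMeasure_map (μ := P n) (hX n).aemeasurable
    rw [e, charFun_eq_integral_exp, integral_map hm.aemeasurable
      (by fun_prop : Measurable _).aestronglyMeasurable, integral_countable]
    · refine tsum_congr fun x => ?_
      have hx : ((P n).map (X n)).real {x} = ‖amplitude U ψ n x‖ ^ 2 := by
        rw [measureReal_def, Measure.map_apply (hX n) (measurableSet_singleton x)]
        have := hP n x
        change (P n (X n ⁻¹' {x})) = _ at this
        rw [this, ENNReal.toReal_ofReal (by positivity)]
      rw [hx, charTerm, Complex.real_smul]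
    · exact Integrable.of_bound measurable_from_top.aestronglyMeasurable 1
        (.of_forall fun _ => (norm_exp_I_mul _).le)

theorem hasSum_norm_sq (hψ : ‖ψ‖ = 1) : HasSum (fun x => ‖ψ x‖ ^ 2) 1 := by
  have h := lp.hasSum_norm (p := 2) (by norm_num) ψ
  simpa [hψ] using h

theorem summable_norm_sq_apply (i : Fin 2) : Summable fun x => ‖ψ x i‖ ^ 2 := by
  have h := (lp.hasSum_norm (p := 2) (by norm_num) ψ).summable
  refine Summable.of_nonneg_of_le (fun x => by positivity) (fun x => ?_) h
  rw [ENNReal.toReal_ofNat, Real.rpow_two]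
  exact pow_le_pow_left₀ (norm_nonneg _) (PiLp.norm_apply_le _ _) 2

theorem tsum_norm_sq_add_tsum_norm_sq (hψ : ‖ψ‖ = 1) :
    (∑' x, ‖ψ x 0‖ ^ 2) + ∑' x, ‖ψ x 1‖ ^ 2 = 1 := by
  rw [← (summable_norm_sq_apply 0).tsum_add (summable_norm_sq_apply 1), ← (hasSum_norm_sq hψ).tsum_eq]
  refine tsum_congr fun x => ?_
  rw [EuclideanSpace.norm_sq_eq, Fin.sum_univ_two]

/-! ### Diagonal coin -/

theorem amplitude_of_diagonal (h01 : U 0 1 = 0) (h10 : U 1 0 = 0)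
    (ψ : ℤ → EuclideanSpace ℂ (Fin 2)) (n : ℕ) : ∀ x,
    amplitude U ψ n x 0 = U 0 0 ^ n * ψ (x + n) 0 ∧
      amplitude U ψ n x 1 = U 1 1 ^ n * ψ (x - n) 1 := by
  induction n with
  | zero => simp [amplitude]
  | succ n ih =>
    intro x
    have h0 : amplitude U ψ (n + 1) x 0 = U 0 0 * amplitude U ψ n (x + 1) 0 := by
      simp [amplitude, leftPart, rightPart, dotProduct, Fin.sum_univ_two, h01]
    have h1 : amplitude U ψ (n + 1) x 1 = U 1 1 * amplitude U ψ n (x - 1) 1 := by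
      simp [amplitude, leftPart, rightPart, dotProduct, Fin.sum_univ_two, h10]
    rw [h0, h1, (ih _).1, (ih _).2]
    rw [pow_succ', pow_succ', mul_assoc, mul_assoc, Nat.cast_succ, add_assoc, add_comm 1, sub_sub,
      add_comm 1]
    exact ⟨rfl, rfl⟩

/-- Reindexing moves the shift into the exponent, where `(x - εn)/n → -ε` for fixed `x`; the
summable `a` dominates. Thus `ε = 1` is the left mover and `ε = -1` the right mover. -/
theorem tendsto_tsum_shift {a : ℤ → ℝ} (ha : Summable a) (h0 : ∀ x, 0 ≤ a x) (ε : ℤ) (ξ : ℝ) :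
    Tendsto (fun n : ℕ => ∑' x : ℤ, (a (x + ε * n) : ℂ)
      * Complex.exp (Complex.I * ((ξ * (x / n) : ℝ) : ℂ))) atTop
      (𝓝 ((∑' x, a x : ℝ) * Complex.exp (Complex.I * ((ξ * (-ε) : ℝ) : ℂ)))) := by
  rw [Complex.ofReal_tsum, ← tsum_mul_right]
  have hshift : ∀ n : ℕ, ∑' x : ℤ, (a (x + ε * n) : ℂ)
      * Complex.exp (Complex.I * ((ξ * (x / n) : ℝ) : ℂ))
      = ∑' x : ℤ, (a x : ℂ) * Complex.exp (Complex.I * ((ξ * ((x - ε * n) / n) : ℝ) : ℂ)) := by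
    intro n
    rw [← (Equiv.addRight (ε * n : ℤ)).tsum_eq
      fun x : ℤ => (a x : ℂ) * Complex.exp (Complex.I * ((ξ * ((x - ε * n) / n) : ℝ) : ℂ))]
    refine tsum_congr fun x => ?_
    simp
  simp_rw [hshift]
  refine tendsto_tsum_of_dominated_convergence ha (fun x => ?_) (.of_forall fun n x => ?_)
  · have h1 : Tendsto (fun n : ℕ => ξ * (((x : ℝ) - ε * n) / n)) atTop (𝓝 (ξ * (-ε))) := by
      have h2 : Tendsto (fun n : ℕ => (x : ℝ) / n - ε) atTop (𝓝 (0 - ε)) :=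
        (tendsto_const_div_atTop_nhds_zero_nat _).sub_const _
      rw [zero_sub] at h2
      refine (h2.congr' ?_).const_mul ξ
      filter_upwards [eventually_gt_atTop 0] with n hn
      have : (n : ℝ) ≠ 0 := by positivity
      field_simp
    have hc : Continuous fun r : ℝ => Complex.exp (Complex.I * (r : ℂ)) := by fun_prop
    exact ((hc.tendsto _).comp h1).const_mul _
  · rw [norm_mul, norm_exp_I_mul, mul_one, Complex.norm_real, Real.norm_of_nonneg (h0 x)]

theorem charFun_two_point {A B : ℝ} (hA : 0 ≤ A) (hB : 0 ≤ B) (ξ : ℝ) :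
    charFun (ENNReal.ofReal A • Measure.dirac (-1) + ENNReal.ofReal B • Measure.dirac 1) ξ
      = A * Complex.exp (Complex.I * ((ξ * (-1) : ℝ) : ℂ))
        + B * Complex.exp (Complex.I * ((ξ * 1 : ℝ) : ℂ)) := by
  have hint : ∀ (r y : ℝ), Integrable (fun y : ℝ => Complex.exp (Complex.I * ((ξ * y : ℝ) : ℂ)))
      (ENNReal.ofReal r • Measure.dirac y) := fun r y =>
    (integrable_exp_I_mul (Measure.dirac y) ξ).smul_measure ENNReal.ofReal_ne_top
  rw [charFun_eq_integral_exp, integral_add_measure (hint _ _) (hint _ _), integral_smul_measure,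
    integral_smul_measure, integral_dirac, integral_dirac, ENNReal.toReal_ofReal hA,
    ENNReal.toReal_ofReal hB, Complex.real_smul, Complex.real_smul]

theorem tendsto_tsum_charTerm_of_diagonal (hU : U ∈ Matrix.unitaryGroup (Fin 2) ℂ)
    (hdet : U.det = 1) (h01 : U 0 1 = 0) (ξ : ℝ) :
    Tendsto (fun n => ∑' x, charTerm U ψ n ξ x) atTop
      (𝓝 (charFun (ENNReal.ofReal (∑' x : ℤ, ‖ψ x 0‖ ^ 2) • Measure.dirac (-1)
        + ENNReal.ofReal (∑' x : ℤ, ‖ψ x 1‖ ^ 2) • Measure.dirac 1) ξ)) := by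
  have h10 : U 1 0 = 0 := by rw [coin_one_zero hU hdet, h01, map_zero, neg_zero]
  have hn0 : ‖U 0 0‖ = 1 := by
    have h := coin_norm_sq hU
    rw [h01, norm_zero, zero_pow two_ne_zero, add_zero] at h
    exact (pow_eq_one_iff_of_nonneg (norm_nonneg _) two_ne_zero).1 h
  have hn1 : ‖U 1 1‖ = 1 := by rw [coin_one_one hU hdet, RCLike.norm_conj, hn0]
  rw [charFun_two_point (tsum_nonneg fun x => by positivity) (tsum_nonneg fun x => by positivity)]
  have hl := tendsto_tsum_shift (summable_norm_sq_apply (ψ := ψ) 0) (fun x => by positivity) 1 ξ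
  have hr := tendsto_tsum_shift (summable_norm_sq_apply (ψ := ψ) 1) (fun x => by positivity) (-1) ξ
  have h := hl.add hr
  rw [Int.cast_neg, Int.cast_one, neg_neg] at h
  refine h.congr fun n => ?_
  have hs : ∀ (i : Fin 2) (ε : ℤ), Summable fun x : ℤ => ((‖ψ (x + ε * n) i‖ ^ 2 : ℝ) : ℂ)
      * Complex.exp (Complex.I * ((ξ * (x / n) : ℝ) : ℂ)) := by
    intro i ε
    refine Summable.of_norm ?_
    simp only [norm_mul, norm_exp_I_mul, mul_one, Complex.norm_real]
    exact ((Equiv.addRight (ε * n : ℤ)).summable_iff.2 (summable_norm_sq_apply (ψ := ψ) i)).norm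
  rw [← (hs 0 1).tsum_add (hs 1 (-1))]
  refine tsum_congr fun x => ?_
  rw [charTerm, EuclideanSpace.norm_sq_eq, Fin.sum_univ_two, (amplitude_of_diagonal h01 h10 ψ n x).1,
    (amplitude_of_diagonal h01 h10 ψ n x).2, norm_mul, norm_mul, norm_pow, norm_pow, hn0, hn1,
    one_pow, one_mul, one_mul, Complex.ofReal_add, add_mul, one_mul, neg_one_mul, ← sub_eq_add_neg]

/-! ### Non-diagonal coin -/

/-- The limit law of the walk for a coin that is not diagonal: each branch is transported by its
group velocity. -/
noncomputable def limitLaw (U : Matrix (Fin 2) (Fin 2) ℂ) (ψ : State) : Measure ℝ :=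
  ∑ s, (volume.withDensity fun q => ENNReal.ofReal (‖circleComponent U ψ s q‖ ^ 2)).map
    (circleVelocity U s)

theorem measurable_norm_circleComponent_sq (s : Fin 2) :
    Measurable fun q => ‖circleComponent U ψ s q‖ ^ 2 :=
  (measurable_circleComponent s).norm.pow_const 2

theorem integral_norm_fourierTransform_sq (i : Fin 2) :
    ∫ q, ‖fourierTransform ψ i q‖ ^ 2 = ∑' x, ‖ψ x i‖ ^ 2 := by
  have h := tsum_sq_fourierCoeff (fourierTransform ψ i)
  rw [integral_haarAddCircle] at h
  have hc : ‖(((√(2 * Real.pi))⁻¹ : ℝ) : ℂ)‖ ^ 2 = (2 * Real.pi)⁻¹ := by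
    rw [Complex.norm_real, Real.norm_eq_abs, sq_abs, inv_pow, Real.sq_sqrt Real.two_pi_pos.le]
  simp only [fourierCoeff_fourierTransform, norm_mul, mul_pow, hc] at h
  rw [tsum_mul_left, smul_eq_mul] at h
  exact (mul_left_cancel₀ (inv_ne_zero Real.two_pi_pos.ne') h).symm

theorem integrable_norm_fourierTransform_sq (i : Fin 2) :
    Integrable fun q => ‖fourierTransform ψ i q‖ ^ 2 :=
  ((Lp.memLp (fourierTransform ψ i)).of_haarAddCircle).integrable_norm_pow (by norm_num)

/-- Pythagoras at each wave number recombines the branches, and Parseval gives total mass `‖ψ‖² =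
1`. -/
theorem isProbabilityMeasure_limitLaw (hU : U ∈ Matrix.unitaryGroup (Fin 2) ℂ) (h01 : U 0 1 ≠ 0)
    (hψ : ‖ψ‖ = 1) : IsProbabilityMeasure (limitLaw U ψ) := by
  constructor
  rw [limitLaw, Measure.finsetSum_apply]
  simp only [Measure.map_apply (measurable_circleVelocity _) MeasurableSet.univ, Set.preimage_univ,
    withDensity_apply _ MeasurableSet.univ, Measure.restrict_univ]
  rw [← lintegral_finsetSum _ fun s _ => (measurable_norm_circleComponent_sq s).ennreal_ofReal]
  have hsum : ∀ q, ∑ s, ENNReal.ofReal (‖circleComponent U ψ s q‖ ^ 2)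
      = ENNReal.ofReal (∑ i, ‖fourierTransform ψ i q‖ ^ 2) := fun q => by
    rw [← sum_norm_sq_circleComponent hU h01,
      ENNReal.ofReal_sum_of_nonneg fun s _ => by positivity]
  simp_rw [hsum]
  rw [← ofReal_integral_eq_lintegral_ofReal
    (integrable_finsetSum _ fun i _ => integrable_norm_fourierTransform_sq i)
    (.of_forall fun q => Finset.sum_nonneg fun i _ => by positivity),
    integral_finsetSum _ fun i _ => integrable_norm_fourierTransform_sq i]
  simp only [integral_norm_fourierTransform_sq, Fin.sum_univ_two]
  rw [tsum_norm_sq_add_tsum_norm_sq hψ, ENNReal.ofReal_one]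

theorem charFun_limitLaw [IsFiniteMeasure (limitLaw U ψ)] (ξ : ℝ) :
    charFun (limitLaw U ψ) ξ
      = ∑ s, ∫ q, Complex.exp (Complex.I * ((ξ * circleVelocity U s q : ℝ) : ℂ))
        * ((‖circleComponent U ψ s q‖ ^ 2 : ℝ) : ℂ) := by
  rw [charFun_eq_integral_exp]
  have hint := integrable_exp_I_mul (limitLaw U ψ) ξ
  rw [limitLaw, integrable_finsetSum_measure] at hint
  rw [limitLaw, integral_finsetSum_measure hint]
  refine Finset.sum_congr rfl fun s _ => ?_
  rw [integral_map (measurable_circleVelocity s).aemeasurable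
    (by fun_prop : Measurable _).aestronglyMeasurable,
    integral_withDensity_eq_integral_toReal_smul
      (measurable_norm_circleComponent_sq s).ennreal_ofReal
      (.of_forall fun _ => ENNReal.ofReal_lt_top)]
  refine integral_congr_ae (.of_forall fun q => ?_)
  beta_reduce
  rw [ENNReal.toReal_ofReal (by positivity), Complex.real_smul, mul_comm]

theorem limitLaw_of_antidiagonal (hU : U ∈ Matrix.unitaryGroup (Fin 2) ℂ) (h01 : U 0 1 ≠ 0)
    (h00 : U 0 0 = 0) (hψ : ‖ψ‖ = 1) : limitLaw U ψ = Measure.dirac 0 := by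
  have hv : ∀ s, circleVelocity U s = fun _ => 0 := by
    intro s
    funext q
    obtain ⟨k, rfl⟩ := exists_coe_add_eq (theta U) q
    rw [circleVelocity_coe]
    simp [groupVelocity, h00]
  have hp := (isProbabilityMeasure_limitLaw hU h01 hψ).measure_univ
  have he : limitLaw U ψ = (limitLaw U ψ Set.univ) • Measure.dirac 0 := by
    simp only [limitLaw, hv, Measure.map_const]
    rw [← Finset.sum_smul]
    simp
  rw [he, hp, one_smul]

end Law

/-! ### Inverting the group velocity: the explicit density. -/

section ChangeOfVariables

variable {U : Matrix (Fin 2) (Fin 2) ℂ} {ψ : State}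

/-- The derivative of `statPoint₁`. -/
noncomputable def statPointDeriv (U : Matrix (Fin 2) (Fin 2) ℂ) (y : ℝ) : ℝ :=
  √(1 - ‖U 0 0‖ ^ 2) / ((1 - y ^ 2) * √(‖U 0 0‖ ^ 2 - y ^ 2))

theorem one_sub_sq_pos_of_abs_lt_one {a : ℝ} (h : |a| < 1) : 0 < 1 - a ^ 2 :=
  sub_pos.2 ((sq_lt_one_iff_abs_lt_one a).2 h)

theorem sq_sub_sq_pos {a y : ℝ} (hy : y ∈ Set.Ioo (-a) a) : 0 < a ^ 2 - y ^ 2 :=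
  sub_pos.2 (sq_lt_sq' hy.1 hy.2)

theorem one_sub_sq_pos_of_mem {a y : ℝ} (h1 : a < 1) (hy : y ∈ Set.Ioo (-a) a) : 0 < 1 - y ^ 2 :=
  one_sub_sq_pos_of_abs_lt_one ((abs_lt.2 hy).trans h1)

/-- This is `cos² c₁(y)`. It keeps `arcsin` inside its smooth range, gives its derivative, and
evaluates `γ'` at `c₁(y)`. -/
theorem one_sub_sin_statPoint_sq (h0 : 0 < ‖U 0 0‖) (h1 : ‖U 0 0‖ < 1) {y : ℝ}
    (hy : y ∈ Set.Ioo (-‖U 0 0‖) ‖U 0 0‖) :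
    1 - (√(1 - ‖U 0 0‖ ^ 2) * y / (‖U 0 0‖ * √(1 - y ^ 2))) ^ 2
      = (‖U 0 0‖ ^ 2 - y ^ 2) / (‖U 0 0‖ ^ 2 * (1 - y ^ 2)) := by
  have ha : 0 < 1 - ‖U 0 0‖ ^ 2 := one_sub_sq_pos_of_abs_lt_one (by rwa [abs_norm])
  have hy1 := one_sub_sq_pos_of_mem h1 hy
  rw [div_pow, mul_pow, mul_pow, Real.sq_sqrt ha.le, Real.sq_sqrt hy1.le]
  field_simp
  ring

theorem abs_sin_statPoint_lt_one (h0 : 0 < ‖U 0 0‖) (h1 : ‖U 0 0‖ < 1) {y : ℝ}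
    (hy : y ∈ Set.Ioo (-‖U 0 0‖) ‖U 0 0‖) :
    |√(1 - ‖U 0 0‖ ^ 2) * y / (‖U 0 0‖ * √(1 - y ^ 2))| < 1 := by
  rw [← sq_lt_one_iff_abs_lt_one, ← sub_pos, one_sub_sin_statPoint_sq h0 h1 hy]
  have := sq_sub_sq_pos hy
  have := one_sub_sq_pos_of_mem h1 hy
  positivity

theorem statPoint_mem (h0 : 0 < ‖U 0 0‖) (h1 : ‖U 0 0‖ < 1) {y : ℝ}
    (hy : y ∈ Set.Ioo (-‖U 0 0‖) ‖U 0 0‖) :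
    statPoint₁ U y ∈ Set.Ioo (-(Real.pi / 2)) (Real.pi / 2) := by
  have h := abs_lt.1 (abs_sin_statPoint_lt_one h0 h1 hy)
  exact ⟨Real.neg_pi_div_two_lt_arcsin.2 h.1, Real.arcsin_lt_pi_div_two.2 h.2⟩

theorem hasDerivAt_statPoint (h0 : 0 < ‖U 0 0‖) (h1 : ‖U 0 0‖ < 1) {y : ℝ}
    (hy : y ∈ Set.Ioo (-‖U 0 0‖) ‖U 0 0‖) :
    HasDerivAt (statPoint₁ U) (statPointDeriv U y) y := by
  have h := abs_lt.1 (abs_sin_statPoint_lt_one h0 h1 hy)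
  have hy1 := one_sub_sq_pos_of_mem h1 hy
  have hay := sq_sub_sq_pos hy
  have hs : HasDerivAt (fun y : ℝ => √(1 - y ^ 2)) (-(2 * y) / (2 * √(1 - y ^ 2))) y := by
    have := ((hasDerivAt_pow 2 y).const_sub 1).sqrt hy1.ne'
    simpa using this
  have hs0 : 0 < √(1 - y ^ 2) := Real.sqrt_pos.2 hy1
  have hu := ((hasDerivAt_id y).const_mul √(1 - ‖U 0 0‖ ^ 2)).div (hs.const_mul ‖U 0 0‖)
    (by positivity)
  have hc := (Real.hasDerivAt_arcsin h.1.ne' h.2.ne).comp y hu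
  refine hc.congr_deriv ?_
  rw [one_sub_sin_statPoint_sq h0 h1 hy, Real.sqrt_div hay.le,
    Real.sqrt_mul (sq_nonneg _), Real.sqrt_sq h0.le, statPointDeriv]
  have hs2 : √(1 - y ^ 2) ^ 2 = 1 - y ^ 2 := Real.sq_sqrt hy1.le
  have hr0 : 0 < √(‖U 0 0‖ ^ 2 - y ^ 2) := Real.sqrt_pos.2 hay
  simp only [id, mul_one]
  set S := √(1 - y ^ 2)
  rw [← hs2]
  field_simp
  rw [hs2]
  ring

theorem groupVelocity_statPoint (h0 : 0 < ‖U 0 0‖) (h1 : ‖U 0 0‖ < 1) {y : ℝ}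
    (hy : y ∈ Set.Ioo (-‖U 0 0‖) ‖U 0 0‖) : groupVelocity U (statPoint₁ U y) = y := by
  have h := abs_lt.1 (abs_sin_statPoint_lt_one h0 h1 hy)
  have ha : 0 < 1 - ‖U 0 0‖ ^ 2 := one_sub_sq_pos_of_abs_lt_one (by rwa [abs_norm])
  have hy1 := one_sub_sq_pos_of_mem h1 hy
  have hs : Real.sin (statPoint₁ U y) = √(1 - ‖U 0 0‖ ^ 2) * y / (‖U 0 0‖ * √(1 - y ^ 2)) :=
    Real.sin_arcsin h.1.le h.2.le
  have hr : 1 - (‖U 0 0‖ * Real.cos (statPoint₁ U y)) ^ 2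
      = (1 - ‖U 0 0‖ ^ 2) / (1 - y ^ 2) := by
    rw [mul_pow, Real.cos_sq', hs, one_sub_sin_statPoint_sq h0 h1 hy]
    field_simp
    ring
  rw [groupVelocity, hr, hs, Real.sqrt_div ha.le]
  have := Real.sqrt_pos.2 ha
  have := Real.sqrt_pos.2 hy1
  field_simp

theorem one_sub_mul_cos_sq_pos (h1 : ‖U 0 0‖ < 1) (k : ℝ) :
    0 < 1 - (‖U 0 0‖ * Real.cos k) ^ 2 :=
  one_sub_sq_pos_of_abs_lt_one (abs_norm_mul_cos_lt_one h1 k)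

theorem groupVelocity_mem (h0 : 0 < ‖U 0 0‖) (h1 : ‖U 0 0‖ < 1) {k : ℝ}
    (hk : k ∈ Set.Ioo (-(Real.pi / 2)) (Real.pi / 2)) :
    groupVelocity U k ∈ Set.Ioo (-‖U 0 0‖) ‖U 0 0‖ := by
  have hc := Real.cos_pos_of_mem_Ioo hk
  have hp := one_sub_mul_cos_sq_pos h1 k
  have ha : 0 < 1 - ‖U 0 0‖ ^ 2 := one_sub_sq_pos_of_abs_lt_one (by rwa [abs_norm])
  refine abs_lt.1 (abs_lt_of_sq_lt_sq ?_ h0.le)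
  rw [groupVelocity, div_pow, Real.sq_sqrt hp.le, div_lt_iff₀ hp, mul_pow]
  refine mul_lt_mul_of_pos_left ?_ (by positivity)
  rw [Real.sin_sq, mul_pow]
  nlinarith [mul_pos ha (pow_pos hc 2)]

/-- Together with `groupVelocity_statPoint` this makes `γ'` a bijection from `(-π/2, π/2)` onto
`(-|l₁|, |l₁|)` with inverse `c₁`. -/
theorem statPoint_groupVelocity (h0 : 0 < ‖U 0 0‖) (h1 : ‖U 0 0‖ < 1) {k : ℝ}
    (hk : k ∈ Set.Ioo (-(Real.pi / 2)) (Real.pi / 2)) :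
    statPoint₁ U (groupVelocity U k) = k := by
  have hp := one_sub_mul_cos_sq_pos h1 k
  have ha : 0 < 1 - ‖U 0 0‖ ^ 2 := one_sub_sq_pos_of_abs_lt_one (by rwa [abs_norm])
  have hv : 1 - groupVelocity U k ^ 2
      = (1 - ‖U 0 0‖ ^ 2) / (1 - (‖U 0 0‖ * Real.cos k) ^ 2) := by
    rw [groupVelocity, div_pow, Real.sq_sqrt hp.le, eq_div_iff hp.ne', sub_mul,
      div_mul_cancel₀ _ hp.ne', mul_pow, mul_pow, Real.sin_sq]
    ring
  have hs : √(1 - ‖U 0 0‖ ^ 2) * groupVelocity U k / (‖U 0 0‖ * √(1 - groupVelocity U k ^ 2))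
      = Real.sin k := by
    rw [hv, Real.sqrt_div ha.le, groupVelocity]
    have := Real.sqrt_pos.2 ha
    have := Real.sqrt_pos.2 hp
    generalize √(1 - (‖U 0 0‖ * Real.cos k) ^ 2) = Q at *
    field_simp
  rw [statPoint₁, hs, Real.arcsin_sin hk.1.le hk.2.le]

theorem image_statPoint (h0 : 0 < ‖U 0 0‖) (h1 : ‖U 0 0‖ < 1) :
    statPoint₁ U '' Set.Ioo (-‖U 0 0‖) ‖U 0 0‖ = Set.Ioo (-(Real.pi / 2)) (Real.pi / 2) := by
  refine Set.Subset.antisymm ?_ fun k hk =>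
    ⟨_, groupVelocity_mem h0 h1 hk, statPoint_groupVelocity h0 h1 hk⟩
  rintro _ ⟨y, hy, rfl⟩
  exact statPoint_mem h0 h1 hy

theorem statPointDeriv_nonneg (h1 : ‖U 0 0‖ < 1) {y : ℝ}
    (hy : y ∈ Set.Ioo (-‖U 0 0‖) ‖U 0 0‖) : 0 ≤ statPointDeriv U y := by
  have := one_sub_sq_pos_of_mem h1 hy
  rw [statPointDeriv]
  positivity

/-- The change of variables `k = σ c₁(y) + d` with `σ = ± 1`. -/
theorem lintegral_Ioo_eq_lintegral_statPoint (h0 : 0 < ‖U 0 0‖) (h1 : ‖U 0 0‖ < 1)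
    {σ : ℝ} (hσ : |σ| = 1) (d : ℝ) (h : ℝ → ℝ≥0∞) :
    ∫⁻ k in Set.Ioo (d - Real.pi / 2) (d + Real.pi / 2), h k
      = ∫⁻ y in Set.Ioo (-‖U 0 0‖) ‖U 0 0‖,
          ENNReal.ofReal (statPointDeriv U y) * h (σ * statPoint₁ U y + d) := by
  have hσ2 : σ * σ = 1 := by rw [← abs_mul_abs_self, hσ, one_mul]
  have himg : (fun y => σ * statPoint₁ U y + d) '' Set.Ioo (-‖U 0 0‖) ‖U 0 0‖
      = Set.Ioo (d - Real.pi / 2) (d + Real.pi / 2) := by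
    rw [← Set.image_image (fun k => σ * k + d), image_statPoint h0 h1]
    ext k
    simp only [Set.mem_image, Set.mem_Ioo]
    -- The interval is symmetric, so the sign `σ` does not change it.
    have key : ∀ r : ℝ, (-(Real.pi / 2) < r ∧ r < Real.pi / 2) ↔
        (-(Real.pi / 2) < σ * r ∧ σ * r < Real.pi / 2) := fun r => by
      rw [← abs_lt, ← abs_lt, abs_mul, hσ, one_mul]
    constructor
    · rintro ⟨r, hr, rfl⟩
      rw [key] at hr
      constructor <;> linarith [hr.1, hr.2]
    · intro hk
      refine ⟨σ * (k - d), (key _).2 ?_, ?_⟩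
      · rw [← mul_assoc, hσ2, one_mul]
        constructor <;> linarith [hk.1, hk.2]
      · rw [← mul_assoc, hσ2, one_mul, sub_add_cancel]
  rw [← himg, lintegral_image_eq_lintegral_abs_deriv_mul measurableSet_Ioo
    (fun y hy => (((hasDerivAt_statPoint h0 h1 hy).const_mul σ).add_const d).hasDerivWithinAt)]
  · refine setLIntegral_congr_fun measurableSet_Ioo fun y hy => ?_
    rw [abs_mul, hσ, one_mul, abs_of_nonneg (statPointDeriv_nonneg h1 hy)]
  · intro y hy y' hy' he
    have he' : statPoint₁ U y = statPoint₁ U y' := by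
      have := congrArg (fun r => σ * (r - d)) he
      simpa [← mul_assoc, hσ2] using this
    rw [← groupVelocity_statPoint h0 h1 hy, he', groupVelocity_statPoint h0 h1 hy']

/-- Cuts a period into two half-periods of length `π`; for `t` a multiple of `π`, `γ'` is injective
on each. The endpoints are null. -/
theorem setLIntegral_period (t : ℝ) (h : ℝ → ℝ≥0∞) :
    ∫⁻ k in Set.Ioc (t - Real.pi / 2) (t - Real.pi / 2 + 2 * Real.pi), h k
      = (∫⁻ k in Set.Ioo (t - Real.pi / 2) (t + Real.pi / 2), h k)
        + ∫⁻ k in Set.Ioo (t + Real.pi - Real.pi / 2) (t + Real.pi + Real.pi / 2), h k := by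
  have hpi := Real.pi_pos
  rw [setLIntegral_congr (Ioo_ae_eq_Ioc (a := t - Real.pi / 2)),
    setLIntegral_congr (Ioo_ae_eq_Ioc (a := t + Real.pi - Real.pi / 2)),
    show t + Real.pi - Real.pi / 2 = t + Real.pi / 2 by ring,
    show t + Real.pi + Real.pi / 2 = t - Real.pi / 2 + 2 * Real.pi by ring,
    ← lintegral_union measurableSet_Ioc (Set.Ioc_disjoint_Ioc_of_le le_rfl),
    Set.Ioc_union_Ioc_eq_Ioc (by linarith) (by linarith)]

/-- The contribution of one branch to the limit law. -/
theorem map_circleVelocity_apply (h0 : 0 < ‖U 0 0‖) (h1 : ‖U 0 0‖ < 1) (s : Fin 2)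
    {σ : ℝ} (hσ : |σ| = 1) (d : ℝ)
    (hd : ∀ k, branchSign s * groupVelocity U (σ * k + d) = groupVelocity U k)
    (hd' : ∀ k, branchSign s * groupVelocity U (-σ * k + (d + Real.pi)) = groupVelocity U k)
    {B : Set ℝ} (hB : MeasurableSet B) :
    (volume.withDensity fun q => ENNReal.ofReal (‖circleComponent U ψ s q‖ ^ 2)).map
        (circleVelocity U s) B
      = (∫⁻ y in Set.Ioo (-‖U 0 0‖) ‖U 0 0‖, ENNReal.ofReal (statPointDeriv U y) *
          B.indicator (fun y => ENNReal.ofReal (branchWeight U ψ s (σ * statPoint₁ U y + d))) y)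
        + ∫⁻ y in Set.Ioo (-‖U 0 0‖) ‖U 0 0‖, ENNReal.ofReal (statPointDeriv U y) *
          B.indicator (fun y =>
            ENNReal.ofReal (branchWeight U ψ s (-σ * statPoint₁ U y + (d + Real.pi)))) y := by
  have hpre := measurable_circleVelocity (U := U) s hB
  -- Translating by `θ₁` passes from `q` to `k`, and the period is chosen to start at `d - π/2` so
  -- that its halves are centred at `d` and `d + π`.
  rw [Measure.map_apply (measurable_circleVelocity s) hB, withDensity_apply _ hpre,
    ← lintegral_indicator hpre, ← lintegral_add_right_eq_self _ (theta U : AddCircle (2 * Real.pi)),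
    ← AddCircle.lintegral_preimage (2 * Real.pi) (d - Real.pi / 2)]
  have hk : ∀ k : ℝ, (circleVelocity U s ⁻¹' B).indicator
      (fun q => ENNReal.ofReal (‖circleComponent U ψ s q‖ ^ 2))
        ((k : AddCircle (2 * Real.pi)) + (theta U : AddCircle (2 * Real.pi)))
      = B.indicator (fun _ => ENNReal.ofReal (branchWeight U ψ s k))
        (branchSign s * groupVelocity U k) := by
    intro k
    classical
    rw [← AddCircle.coe_add, Set.indicator_apply, Set.indicator_apply, Set.mem_preimage,
      circleVelocity_coe, circleComponent_coe, norm_branchComponent_sq]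
  simp_rw [hk]
  have hσ' : |-σ| = 1 := by rw [abs_neg, hσ]
  rw [setLIntegral_period, lintegral_Ioo_eq_lintegral_statPoint h0 h1 hσ d,
    lintegral_Ioo_eq_lintegral_statPoint h0 h1 hσ' (d + Real.pi)]
  simp only [hd, hd']
  congr 1 <;>
  · refine setLIntegral_congr_fun measurableSet_Ioo fun y hy => ?_
    classical
    simp only [Set.indicator_apply, groupVelocity_statPoint h0 h1 hy]

theorem groupVelocity_neg (k : ℝ) : groupVelocity U (-k) = -groupVelocity U k := by
  simp only [groupVelocity, Real.sin_neg, Real.cos_neg]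
  ring

theorem groupVelocity_add_pi (k : ℝ) : groupVelocity U (k + Real.pi) = -groupVelocity U k := by
  simp only [groupVelocity, Real.sin_add_pi, Real.cos_add_pi, mul_neg, neg_sq, neg_div]

theorem measurable_statPoint : Measurable (statPoint₁ U) := by
  unfold statPoint₁
  exact Real.measurable_arcsin.comp (by fun_prop)

theorem measurable_branchWeight (s : Fin 2) : Measurable (branchWeight U ψ s) := by
  simp_rw [funext fun k => (norm_branchComponent_sq (U := U) (ψ := ψ) s k).symm]
  exact (measurable_branchComponent s).norm.pow_const 2

theorem branchWeight_nonneg (s : Fin 2) (k : ℝ) : 0 ≤ branchWeight U ψ s k := by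
  rw [branchWeight]
  positivity

/-- The `π` in `g` cancels the one in the denominator, so the prefactor is exactly the Jacobian
`c₁'(y)`. -/
theorem limitDensity_of_mem (h1 : ‖U 0 0‖ < 1) {y : ℝ} (hy : y ∈ Set.Ioo (-‖U 0 0‖) ‖U 0 0‖) :
    ENNReal.ofReal (limitDensity U ψ y)
      = ENNReal.ofReal (statPointDeriv U y) *
          (ENNReal.ofReal (branchWeight U ψ 0 (statPoint₁ U y))
            + ENNReal.ofReal (branchWeight U ψ 0 (statPoint₂ U y))
            + ENNReal.ofReal (branchWeight U ψ 1 (-statPoint₁ U y))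
            + ENNReal.ofReal (branchWeight U ψ 1 (-statPoint₂ U y))) := by
  have hw := branchWeight_nonneg (U := U) (ψ := ψ)
  rw [← ENNReal.ofReal_add (hw _ _) (hw _ _),
    ← ENNReal.ofReal_add (add_nonneg (hw _ _) (hw _ _)) (hw _ _),
    ← ENNReal.ofReal_add (add_nonneg (add_nonneg (hw _ _) (hw _ _)) (hw _ _)) (hw _ _),
    ← ENNReal.ofReal_mul (statPointDeriv_nonneg h1 hy), limitDensity, Set.indicator_of_mem hy,
    initialFactor, ← mul_assoc, statPointDeriv]
  congr 2
  rw [mul_assoc, div_mul_eq_mul_div, mul_comm _ Real.pi, mul_div_mul_left _ _ Real.pi_ne_zero]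

/-- For the plus branch, `d = 0` gives the preimages `c₁` and `-c₁ + π = c₂`. For the minus branch,
`d = -π` gives `c₁ - π = -c₂` and `-c₁`. These are the four terms of `g`. -/
theorem limitLaw_eq_withDensity (h0 : 0 < ‖U 0 0‖) (h1 : ‖U 0 0‖ < 1) :
    limitLaw U ψ = volume.withDensity fun y => ENNReal.ofReal (limitDensity U ψ y) := by
  ext B hB
  rw [limitLaw, Measure.finsetSum_apply, Fin.sum_univ_two,
    map_circleVelocity_apply h0 h1 0 (σ := 1) (by simp) 0
      (fun k => by simp [branchSign])
      (fun k => by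
        rw [zero_add, groupVelocity_add_pi, neg_one_mul, groupVelocity_neg]
        simp [branchSign]) hB,
    map_circleVelocity_apply h0 h1 1 (σ := 1) (by simp) (-Real.pi)
      (fun k => by
        have h := groupVelocity_add_pi (U := U) (k + -Real.pi)
        rw [neg_add_cancel_right] at h
        simp [branchSign, h])
      (fun k => by
        rw [neg_add_cancel, add_zero, neg_one_mul, groupVelocity_neg]
        simp [branchSign]) hB]
  have hs := measurable_statPoint (U := U)
  have hJ : Measurable (statPointDeriv U) := by
    unfold statPointDeriv
    fun_prop
  have hm : ∀ (s : Fin 2) (σ d : ℝ), Measurable fun y => ENNReal.ofReal (statPointDeriv U y) *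
      B.indicator (fun y => ENNReal.ofReal (branchWeight U ψ s (σ * statPoint₁ U y + d))) y :=
    fun s σ d => hJ.ennreal_ofReal.mul (Measurable.indicator
      (((measurable_branchWeight s).comp ((hs.const_mul σ).add_const d)).ennreal_ofReal) hB)
  rw [add_assoc, ← lintegral_add_left (hm _ _ _), ← lintegral_add_left (hm _ _ _),
    ← lintegral_add_left (hm _ _ _), withDensity_apply _ hB,
    ← lintegral_indicator hB, ← lintegral_indicator measurableSet_Ioo]
  congr 1 with y
  by_cases hy : y ∈ Set.Ioo (-‖U 0 0‖) ‖U 0 0‖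
  · rw [Set.indicator_of_mem hy]
    by_cases hyB : y ∈ B
    · simp only [Set.indicator_of_mem hyB]
      rw [limitDensity_of_mem h1 hy, statPoint₂]
      simp only [one_mul, add_zero, zero_add, neg_one_mul, neg_add_cancel,
        sub_eq_add_neg, neg_add_rev, neg_neg, add_comm (-statPoint₁ U y) Real.pi]
      ring
    · simp [Set.indicator_of_notMem hyB]
  · have hz : limitDensity U ψ y = 0 := Set.indicator_of_notMem hy _
    simp only [Set.indicator_of_notMem hy]
    by_cases hyB : y ∈ B
    · rw [Set.indicator_of_mem hyB, hz, ENNReal.ofReal_zero]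
    · rw [Set.indicator_of_notMem hyB]

end ChangeOfVariables

end QuantumWalk

/-! ### The limit theorem. -/

theorem theorem2p1 (U : Matrix (Fin 2) (Fin 2) ℂ) (hU : U ∈ Matrix.unitaryGroup (Fin 2) ℂ)
    (hdet : U.det = 1) (ψ₀ : QuantumWalk.State) (hψ₀ : ‖ψ₀‖ = 1) :
    ∃ (Ω' : Type) (_ : MeasurableSpace Ω') (Q : Measure Ω') (_ : IsProbabilityMeasure Q)
      (Z : Ω' → ℝ), Measurable Z ∧
      (∀ (Ω : ℕ → Type*) [∀ n, MeasurableSpace (Ω n)] (P : ∀ n, Measure (Ω n))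
        [∀ n, IsProbabilityMeasure (P n)] (X : ∀ n, Ω n → ℤ),
        (∀ n, Measurable (X n)) →
        (∀ n x, P n {ω | X n ω = x} =
          ENNReal.ofReal (‖QuantumWalk.amplitude U ψ₀ n x‖ ^ 2)) →
        TendstoInDistribution (fun n ω => (X n ω : ℝ) / n) atTop Z P Q) ∧
      (U 0 0 * U 0 1 * U 1 0 * U 1 1 ≠ 0 →
        Q.map Z =
          volume.withDensity fun y => ENNReal.ofReal (QuantumWalk.limitDensity U ψ₀ y)) ∧
      (U 0 1 = 0 →
        Q.map Z = ENNReal.ofReal (∑' x : ℤ, ‖ψ₀ x 0‖ ^ 2) • Measure.dirac (-1)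
          + ENNReal.ofReal (∑' x : ℤ, ‖ψ₀ x 1‖ ^ 2) • Measure.dirac 1) ∧
      (U 0 0 = 0 → Q.map Z = Measure.dirac 0) := by
  by_cases h01 : U 0 1 = 0
  -- The first row of the coin has norm `1`, so `l₁` and `l₂` cannot both vanish and the third case
  -- is void here.
  · have hn0 : U 0 0 ≠ 0 := fun h00 => by
      have h := QuantumWalk.coin_norm_sq hU
      simp [h00, h01] at h
    set ν : Measure ℝ := ENNReal.ofReal (∑' x : ℤ, ‖ψ₀ x 0‖ ^ 2) • Measure.dirac (-1)
      + ENNReal.ofReal (∑' x : ℤ, ‖ψ₀ x 1‖ ^ 2) • Measure.dirac 1 with hν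
    have hprob : IsProbabilityMeasure ν := by
      constructor
      rw [hν, Measure.add_apply, Measure.smul_apply, Measure.smul_apply, measure_univ, measure_univ,
        smul_eq_mul, smul_eq_mul, mul_one, mul_one,
        ← ENNReal.ofReal_add (tsum_nonneg fun x => by positivity)
          (tsum_nonneg fun x => by positivity),
        QuantumWalk.tsum_norm_sq_add_tsum_norm_sq hψ₀, ENNReal.ofReal_one]
    -- `Z` is realised as the identity on `ℝ` equipped with the limit law itself.
    refine ⟨ℝ, inferInstance, ν, hprob, id, measurable_id, ?_, ?_, fun _ => Measure.map_id,
      fun h => absurd h hn0⟩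
    · intro Ω _ P _ X hX hP
      exact QuantumWalk.tendstoInDistribution_of_tendsto_tsum_charTerm ν
        (QuantumWalk.tendsto_tsum_charTerm_of_diagonal hU hdet h01) Ω P X hX hP
    · intro h
      simp [h01] at h
  · have hprob := QuantumWalk.isProbabilityMeasure_limitLaw hU h01 hψ₀
    refine ⟨ℝ, inferInstance, QuantumWalk.limitLaw U ψ₀, hprob, id, measurable_id, ?_, ?_,
      fun h => absurd h h01, ?_⟩
    · intro Ω _ P _ X hX hP
      refine QuantumWalk.tendstoInDistribution_of_tendsto_tsum_charTerm _ (fun ξ => ?_) Ω P X hX hP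
      rw [QuantumWalk.charFun_limitLaw]
      exact QuantumWalk.tendsto_tsum_charTerm hU hdet h01 ξ
    · intro h
      have h00 : U 0 0 ≠ 0 := fun h00 => by simp [h00] at h
      rw [Measure.map_id]
      exact QuantumWalk.limitLaw_eq_withDensity (norm_pos_iff.2 h00)
        (QuantumWalk.coin_norm_lt_one hU h01)
    · intro h00
      rw [Measure.map_id]
      exact QuantumWalk.limitLaw_of_antidiagonal hU h01 h00 hψ₀
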